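/- Let $G=(V,E)$ be a finite, connected, simple undirected graph, with adjacency matrix $A$, degree matrix $D=\mathrm{diag}(d_u)$ and Laplacian $L=D-A$; let $v\in V$, and let $L_v$ be $L$ with the $v$-th row and column removed. Run Wilson's algorithm rooted at $v$, for an arbitrary fixed ordering of $V\setminus\{v\}$: initially every stack $S[u]$ is empty and only $v$ is gray. Start a walk at the first non-gray vertex of the ordering. From the current vertex $u$ choose a uniformly random neighbour $w$ of $u$ (independently of the past), push $w$ on top of $S[u]$, and move to $w$, keeping the loop-erased trajectory of the current walk (each loop is erased from the trajectory when it closes, but its entries stay in the stacks). When a gray vertex is reached, mark the vertices of the loop-erased trajectory gray and start a new walk at the first non-gray vertex of the ordering; stop when all vertices are gray. From the final stacks, form the loop-included path $P[s]$ for $s\in V$: start at $s$ and, until $v$ is reached, jump from the current vertex $u$ to the bottom entry of $S[u]$ and remove this entry from $S[u]$. Then the algorithm stops almost surely, $L_v$ is invertible, and: 1. For all $s,u\in V\setminus\{v\}$, the number of occurrences of $u$ in $P[s]$ (including the start) has finite expectation $\tau[s,u]$, and $(L_v^{-1})_{su}=\tau[s,u]/d_u$. 2. For all $s\in V\setminus\{v\}$,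 let $N_s$ be the number of times at which $s$ is the current vertex from which a step is taken during the whole run (arriving at an already gray vertex, which ends a walk, is not counted). Almost surely $N_s$ is the number of entries of the final stack $S[s]$; $N_s$ has finite expectation, and $(L_v^{-1})_{ss}=\mathbb{E}[N_s]/d_s$. 3. For every $s\in V$, $P[s]$ has the same distribution as the trajectory of a $v$-absorbed random walk from $s$, i.e. a simple random walk on $G$ started at $s$ and stopped at its first visit to $v$. -/

import Mathlib

namespace LEWalk

/-- `X` is a (time-homogeneous, discrete-time) Markov chain on `S` under the probability measure
`μ`, started at `x₀`, with one-step transition law `p`: the probability of each finite history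
is the product of its transition probabilities. -/
structure IsMarkovChain {Ω S : Type*} [MeasurableSpace Ω] (μ : MeasureTheory.Measure Ω)
    (p : S → PMF S) (x₀ : S) (X : ℕ → Ω → S) : Prop where
  isProbabilityMeasure : MeasureTheory.IsProbabilityMeasure μ
  measurableSet : ∀ n x, MeasurableSet {ω | X n ω = x}
  start : ∀ᵐ ω ∂μ, X 0 ω = x₀
  history : ∀ (n : ℕ) (x : ℕ → S), x 0 = x₀ →
    μ {ω | ∀ i ≤ n, X i ω = x i} = ∏ i ∈ Finset.range n, p (x i) (x (i + 1))

section Graph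

variable {V : Type*} [Fintype V] [DecidableEq V] (G : SimpleGraph V) [DecidableRel G.Adj]

/-- A uniformly random neighbour of `u`, i.e. row `u` of `P = D⁻¹ A`. (An isolated vertex, which
occurs in a connected graph only if it is the only vertex, is sent to itself.) -/
noncomputable def randomNeighbor (u : V) : PMF V :=
  if h : (G.neighborFinset u).Nonempty then PMF.uniformOfFinset (G.neighborFinset u) h
  else PMF.pure u

/-- The matrix `L_v`: the Laplacian `L = D - A` without its `v`-th row and column. -/
def reducedLaplacian (v : V) : Matrix {u : V // u ≠ v} {u : V // u ≠ v} ℝ :=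
  (G.lapMatrix ℝ).submatrix Subtype.val Subtype.val

end Graph

section Wilson

variable {V : Type*} [DecidableEq V]

/-- State of Wilson's algorithm in its stack representation, with erased loops kept.
* `stack u`: the stack `S[u]`, listed from bottom to top;
* `gray`: the vertices already marked gray (the vertices of the tree built so far);
* `trail`: the loop-erased trajectory of the walk in progress, most recent vertex first; its head
  is the current position. It is empty once the algorithm has stopped. -/
structure State (V : Type*) where
  stack : V → List V
  gray : Finset V
  trail : List V

/-- The trajectory with which the next walk starts: the first vertex of `order` that is not gray,
alone; no trajectory if there is none. -/
def nextTrail (order : List V) (gray : Finset V) : List V :=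
  (order.find? fun u => u ∉ gray).toList

/-- Initially all stacks are empty and only the root is gray. -/
def State.init (order : List V) (v : V) : State V where
  stack := fun _ => []
  gray := {v}
  trail := nextTrail order {v}

/-- Extend a loop-erased trajectory (most recent vertex first) by `w`, erasing the loop that is
closed if `w` already lies on it. -/
def extendTrail (w : V) (trail : List V) : List V :=
  if w ∈ trail then trail.dropWhile fun x => x ≠ w else w :: trail

/-- One step of the algorithm, from the current vertex `u` to the selected neighbour `w`: push `w`
on top of `S[u]`. If `w` is gray, the walk ends: mark its loop-erased trajectory gray and start a
new walk. Otherwise the walk goes on from `w`. Entries of the stacks are never removed. -/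
def State.step (order : List V) (σ : State V) (w : V) : State V :=
  match σ.trail with
  | [] => σ
  | u :: t =>
    let stack' := Function.update σ.stack u (σ.stack u ++ [w])
    if w ∈ σ.gray then
      let gray' := σ.gray ∪ (u :: t).toFinset
      { stack := stack', gray := gray', trail := nextTrail order gray' }
    else
      { stack := stack', gray := σ.gray, trail := extendTrail w (u :: t) }

/-- Transition law of Wilson's algorithm: the vertex `w` is a uniformly random neighbour of the
current vertex. A state in which the algorithm has stopped is kept forever. -/
noncomputable def wilson [Fintype V] (G : SimpleGraph V) [DecidableRel G.Adj] (order : List V)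
    (σ : State V) : PMF (State V) :=
  match σ.trail with
  | [] => PMF.pure σ
  | u :: _ => (randomNeighbor G u).map (σ.step order)

open Classical in
/-- The stacks when the run `X` stops. -/
noncomputable def finalStacks (X : ℕ → State V) : V → List V :=
  if h : ∃ n, (X n).trail = [] then (X (Nat.find h)).stack else fun _ => []

/-- The number of visits to `s` in the whole run `X`: the number of times at which the current
vertex, from which the next step is taken, is `s`. -/
noncomputable def visits (X : ℕ → State V) (s : V) : ℕ :=
  {n : ℕ | (X n).trail.head? = some s}.ncard

/-- Read off a path from the stacks `S`, starting at `u`: until the root `v` is reached, jump from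
`u` to the bottom entry of `S[u]` and remove that entry. At most `fuel` jumps are made. -/
def readPath (v : V) : ℕ → (V → List V) → V → List V
  | 0, _, u => [u]
  | fuel + 1, S, u =>
    if u = v then [u]
    else match S u with
      | [] => [u]
      | w :: rest => u :: readPath v fuel (Function.update S u rest) w

/-- The loop-included path from `s`, as its list of vertices including `s` and the root. Every jump
removes one stack entry, so the total number of entries bounds the number of jumps. -/
def loopIncludedPath [Fintype V] (v : V) (S : V → List V) (s : V) : List V :=
  readPath v (∑ u, (S u).length) S s

open Classical in
/-- The list of vertices of a walk `W` absorbed at `v`: its positions up to and including its first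
visit to `v` (the empty list if `v` is never visited). -/
noncomputable def absorbedPath (v : V) (W : ℕ → V) : List V :=
  if h : ∃ n, W n = v then (List.range (Nat.find h + 1)).map W else []

end Wilson

end LEWalk

/-! Two facts carry the theorem: a counting argument on the final stacks of a single run, and a
comparison of the law of the loop-included path with that of an absorbed walk.

Counting. Every step preserves `Inv`: the top entries of the gray vertices form a tree directed to
`v`, those of the walk in progress form a chain, and the remaining entries are balanced (each vertex
is entered as often as it is left). When the run has stopped, the stacks are therefore a spanning
tree lying on top of an Eulerian arrangement of entries. By `end_eq_root_and_start_exhausted`,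
reading off a path from `s ≠ v` can then only get stuck at `v`, and it has used up the whole stack
of `s`. Hence `P[s]` visits `s` exactly `|S[s]| = N_s` times, which derives statement 2 from
statement 1.

Law of the path. For prescribed bottom entries `T`, the conditional probability that independently
completed stacks begin with `T` is a martingale along the run (`tsum_wilson_prod_prefixProb`).
Fatou's lemma bounds the probability that the final stacks begin with `T` by the product of the
transition probabilities. Applied to the entries used by a path `γ`, this gives `P(P[s] = γ) ≤
pathWeight γ`. The weights sum to at most 1 and the probabilities to exactly 1, so equality holds
throughout (`lintegral_runPath`). No independence of the stacks is ever needed, and comparison with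
an absorbed walk gives statement 3.

Expectations. A first-step decomposition of the path weights shows that `s ↦ τ[s,u]` solves the
linear system `L_v x = d_u e_u`, so it is `d_u` times a column of the inverse. Finiteness and
termination come from a Lyapunov function built from a solution of the hitting-time equations
(`potential_drift`): the expected number of steps is finite, and it bounds the stack heights, which
bound the numbers of visits along `P[s]`. -/

namespace LEWalk

/-! ### Invariants of the algorithm: tree, chain and balance of the stack entries -/

section Deterministic

variable {V : Type*}

/-- `u` is led to the root `v` by the top entries of the stacks of the vertices of `Γ`. -/
inductive Rooted (v : V) (S : V → List V) (Γ : Finset V) : V → Prop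
  | root : Rooted v S Γ v
  | step {u w : V} : u ∈ Γ → (S u).getLast? = some w → Rooted v S Γ w → Rooted v S Γ u

theorem Rooted.mono {v : V} {S S' : V → List V} {Γ Γ' : Finset V} (hΓ : Γ ⊆ Γ')
    (hS : ∀ u ∈ Γ, S' u = S u) {u : V} (h : Rooted v S Γ u) : Rooted v S' Γ' u := by
  induction h with
  | root => exact .root
  | step hu hw _ ih => exact .step (hΓ hu) (by rwa [hS _ hu]) ih

/-- Following the tops from `u` leads to the root, so it has to leave `F` somewhere. -/
theorem Rooted.exists_top_notMem {v : V} {S : V → List V} {Γ F : Finset V} (hF : v ∉ F) {u : V}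
    (h : Rooted v S Γ u) (hu : u ∈ F) : ∃ c ∈ F, ∀ w ∈ F, (S c).getLast? ≠ some w := by
  induction h with
  | root => exact absurd hu hF
  | @step u w _ hw _ ih =>
    by_cases hwF : w ∈ F
    · exact ih hwF
    · refine ⟨u, hu, fun x hx h => hwF ?_⟩
      rw [hw] at h
      exact (Option.some.inj h) ▸ hx

theorem rooted_of_isChain (v : V) (S : V → List V) (Γ : Finset V) (w : V) (l : List V)
    (h : (w :: l).IsChain fun a b => (S b).getLast? = some a) (hw : Rooted v S Γ w)
    (hl : ∀ u ∈ l, u ∈ Γ) : ∀ u ∈ l, Rooted v S Γ u := by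
  induction l generalizing w with
  | nil => simp
  | cons b l ih =>
    rw [List.isChain_cons_cons] at h
    have hb : Rooted v S Γ b := .step (hl b (by simp)) h.1 hw
    intro u hu
    rcases List.mem_cons.1 hu with rfl | hu
    · exact hb
    · exact ih b h.2 hb (fun u hu => hl u (by simp [hu])) u hu

variable [DecidableEq V]

/-- The stack entries used by a path: for each vertex, the list of its successors on the path. -/
def pathStacks : List V → V → List V
  | [] => fun _ => []
  | [_] => fun _ => []
  | a :: b :: l => Function.update (pathStacks (b :: l)) a (b :: pathStacks (b :: l) a)

theorem sum_apply_update [Fintype V] (F : V → List V → ℕ) (S : V → List V) (u : V) (l : List V) :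
    ∑ c, F c (Function.update S u l c) + F u (S u) = ∑ c, F c (S c) + F u l := by
  rw [← Finset.add_sum_erase _ _ (Finset.mem_univ u), ← Finset.add_sum_erase _ (fun c => F c (S c))
    (Finset.mem_univ u)]
  have : ∑ c ∈ Finset.univ.erase u, F c (Function.update S u l c) =
      ∑ c ∈ Finset.univ.erase u, F c (S c) :=
    Finset.sum_congr rfl fun c hc => by
      rw [Function.update_of_ne (Finset.ne_of_mem_erase hc)]
  rw [this, Function.update_self]
  ring

/-- A path leaves `x` at every occurrence except a final one. With `sum_count_pathStacks`, where the
exception is the starting point, this is the flow balance of the path. -/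
theorem length_pathStacks (x a : V) (l : List V) :
    (pathStacks (a :: l) x).length + (if (a :: l).getLast? = some x then 1 else 0) =
      (a :: l).count x := by
  induction l generalizing a with
  | nil => simp [pathStacks, List.count_cons]
  | cons b l ih =>
    have := ih b
    rw [List.getLast?_cons_cons, List.count_cons, ← this]
    by_cases h : a = x
    · subst h; simp [pathStacks]; omega
    · simp [pathStacks, Function.update_of_ne (Ne.symm h), h]

theorem sum_count_pathStacks [Fintype V] (x a : V) (l : List V) :
    ∑ c, (pathStacks (a :: l) c).count x + (if a = x then 1 else 0) = (a :: l).count x := by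
  induction l generalizing a with
  | nil => simp [pathStacks, List.count_cons]
  | cons b l ih =>
    have := ih b
    have h2 := sum_apply_update (fun _ => List.count x) (pathStacks (b :: l)) a
      (b :: pathStacks (b :: l) a)
    rw [List.count_cons (l := b :: l), ← this]
    simp only [pathStacks]
    simp only [List.count_cons, beq_iff_eq] at h2 ⊢
    omega

/-- Each vertex of the chain except the last is the top of its successor. This counts the tree edges
gained when a branch is attached to the gray vertex `w`. -/
theorem countP_top_of_isChain (S : V → List V) (x w : V) (l : List V)
    (h : (w :: l).IsChain fun a b => (S b).getLast? = some a) :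
    l.countP (fun c => (S c).getLast? = some x) +
      (if (w :: l).getLast? = some x then 1 else 0) = (if w = x then 1 else 0) + l.count x := by
  induction l generalizing w with
  | nil => simp
  | cons b l ih =>
    rw [List.isChain_cons_cons] at h
    have := ih b h.2
    rw [List.getLast?_cons_cons, List.countP_cons, List.count_cons]
    simp only [h.1, decide_eq_true_eq, Option.some.injEq, beq_iff_eq]
    omega

/-- The properties of a state that every step of the algorithm preserves. The last one says that
every vertex is entered as often as it is left, up to the tree edges and the walk in progress. -/
structure Inv [Fintype V] (order : List V) (v : V) (σ : State V) : Prop where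
  root_mem : v ∈ σ.gray
  stack_root : σ.stack v = []
  rooted : ∀ u ∈ σ.gray, Rooted v σ.stack σ.gray u
  notMem_gray : ∀ u ∈ σ.trail, u ∉ σ.gray
  nodup : σ.trail.Nodup
  chain : σ.trail.IsChain fun a b => (σ.stack b).getLast? = some a
  stopped : σ.trail = [] → ∀ u ∈ order, u ∈ σ.gray
  balance : ∀ x, ∑ c, (σ.stack c).count x + (if x ∈ σ.gray.erase v then 1 else 0) +
      (if σ.trail.getLast? = some x then 1 else 0) =
    (σ.stack x).length + ((σ.gray.erase v).filter fun c => (σ.stack c).getLast? = some x).card +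
      (if σ.trail.head? = some x then 1 else 0)

theorem getLast?_nextTrail (order : List V) (Γ : Finset V) :
    (nextTrail order Γ).getLast? = (nextTrail order Γ).head? := by
  unfold nextTrail; cases order.find? fun u => u ∉ Γ <;> simp

theorem notMem_of_mem_nextTrail {order : List V} {Γ : Finset V} {u : V}
    (h : u ∈ nextTrail order Γ) : u ∉ Γ := by
  unfold nextTrail at h
  have := List.find?_some (Option.mem_toList.1 h)
  simpa using this

theorem nodup_nextTrail (order : List V) (Γ : Finset V) : (nextTrail order Γ).Nodup := by
  unfold nextTrail; cases order.find? fun u => u ∉ Γ <;> simp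

theorem isChain_nextTrail (R : V → V → Prop) (order : List V) (Γ : Finset V) :
    (nextTrail order Γ).IsChain R := by
  unfold nextTrail; cases order.find? fun u => u ∉ Γ <;> simp

theorem mem_of_nextTrail_eq_nil {order : List V} {Γ : Finset V} (h : nextTrail order Γ = [])
    {u : V} (hu : u ∈ order) : u ∈ Γ := by
  have : order.find? (fun u => u ∉ Γ) = none := by
    unfold nextTrail at h; simpa using h
  simpa using List.find?_eq_none.1 this u hu

theorem inv_init [Fintype V] (order : List V) (v : V) : Inv order v (State.init order v) where
  root_mem := by simp [State.init]
  stack_root := rfl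
  rooted u hu := by
    obtain rfl : u = v := by simpa [State.init] using hu
    exact .root
  notMem_gray u hu := notMem_of_mem_nextTrail hu
  nodup := nodup_nextTrail _ _
  chain := isChain_nextTrail _ _ _
  stopped h u hu := mem_of_nextTrail_eq_nil h hu
  balance x := by simp [State.init, getLast?_nextTrail]; congr!

theorem extendTrail_cases (w : V) (l : List V) :
    (w ∉ l ∧ extendTrail w l = w :: l) ∨
      ∃ l₁ l₂, l = l₁ ++ w :: l₂ ∧ extendTrail w l = w :: l₂ := by
  unfold extendTrail
  split_ifs with h
  · right
    induction l with
    | nil => simp at h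
    | cons a l ih =>
      by_cases haw : a = w
      · exact ⟨[], l, by simp [haw], by simp [haw]⟩
      · obtain ⟨l₁, l₂, h1, h2⟩ := ih ((List.mem_cons.1 h).resolve_left (Ne.symm haw))
        exact ⟨a :: l₁, l₂, by simp [h1], by simpa [List.dropWhile_cons, haw] using h2⟩
  · exact .inl ⟨h, rfl⟩

theorem head?_extendTrail (w : V) (l : List V) : (extendTrail w l).head? = some w := by
  rcases extendTrail_cases w l with ⟨_, h⟩ | ⟨_, _, _, h⟩ <;> simp [h]

/-- Loop erasure never removes the starting point of the walk, which is what keeps the corresponding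
term of `Inv.balance` constant. -/
theorem getLast?_extendTrail (w u : V) (t : List V) :
    (extendTrail w (u :: t)).getLast? = (u :: t).getLast? := by
  rcases extendTrail_cases w (u :: t) with ⟨_, h⟩ | ⟨l₁, l₂, h', h⟩
  · simp [h]
  · rw [h, h', List.getLast?_append_cons]

theorem mem_extendTrail {w x : V} {l : List V} (h : x ∈ extendTrail w l) : x = w ∨ x ∈ l := by
  rcases extendTrail_cases w l with ⟨_, h'⟩ | ⟨l₁, l₂, h1, h'⟩
  · rw [h'] at h; simpa using h
  · right
    rw [h'] at h; rw [h1]; simp only [List.mem_append]; exact .inr h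

theorem inv_step_of_mem [Fintype V] {order : List V} {v : V} {σ : State V} (h : Inv order v σ)
    {u : V} {t : List V} (ht : σ.trail = u :: t) {w : V} (hw : w ∈ σ.gray) :
    Inv order v (σ.step order w) := by
  have huG : u ∉ σ.gray := h.notMem_gray u (by simp [ht])
  have htG : ∀ c ∈ u :: t, c ∉ σ.gray := by rw [← ht]; exact h.notMem_gray
  have hnd : (u :: t).Nodup := by rw [← ht]; exact h.nodup
  have huv : u ≠ v := fun e => huG (e ▸ h.root_mem)
  have hS : ∀ c, c ≠ u → Function.update σ.stack u (σ.stack u ++ [w]) c = σ.stack c :=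
    fun c hc => Function.update_of_ne hc _ _
  have hSG : ∀ c ∈ σ.gray, Function.update σ.stack u (σ.stack u ++ [w]) c = σ.stack c :=
    fun c hc => hS c fun e => huG (e ▸ hc)
  -- Pushing `w` makes it the top of `u`. The other tops on the trajectory are untouched since `u`
  -- does not recur there, so the whole branch now leads to the gray vertex `w`.
  have hchain : (w :: u :: t).IsChain fun a b =>
      (Function.update σ.stack u (σ.stack u ++ [w]) b).getLast? = some a := by
    rw [List.isChain_cons_cons]
    refine ⟨by simp, ?_⟩
    have hc := h.chain
    rw [ht] at hc
    cases t with
    | nil => simp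
    | cons b t =>
      rw [List.isChain_cons_cons] at hc ⊢
      have hub : b ≠ u := by rintro rfl; simp at hnd
      refine ⟨by rw [hS _ hub]; exact hc.1, ?_⟩
      refine hc.2.imp_of_mem_imp fun a c _ hc' hac => ?_
      rw [hS _ (by rintro rfl; exact (List.nodup_cons.1 hnd).1 hc')]
      exact hac
  simp only [State.step, ht, hw, if_true]
  set S' := Function.update σ.stack u (σ.stack u ++ [w]) with hS'
  have hsub : σ.gray ⊆ σ.gray ∪ (u :: t).toFinset := Finset.subset_union_left
  have hrG : ∀ c ∈ σ.gray, Rooted v S' (σ.gray ∪ (u :: t).toFinset) c :=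
    fun c hc => (h.rooted c hc).mono hsub hSG
  refine ⟨hsub h.root_mem, ?_, ?_, fun c => notMem_of_mem_nextTrail, nodup_nextTrail _ _,
    isChain_nextTrail _ _ _, fun h u hu => mem_of_nextTrail_eq_nil h hu, fun x => ?_⟩
  · exact (hS v huv.symm).trans h.stack_root
  · intro c hc
    rcases Finset.mem_union.1 hc with hc | hc
    · exact hrG c hc
    · exact rooted_of_isChain v S' _ w (u :: t) hchain (hrG w hw)
        (fun c hc => Finset.mem_union_right _ (List.mem_toFinset.2 hc)) c (List.mem_toFinset.1 hc)
  · have hb := h.balance x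
    have h1 := sum_apply_update (fun _ => List.count x) σ.stack u (σ.stack u ++ [w])
    have h2 := countP_top_of_isChain S' x w (u :: t) hchain
    have h3 : (σ.gray ∪ (u :: t).toFinset).erase v = σ.gray.erase v ∪ (u :: t).toFinset := by
      rw [Finset.erase_union_distrib, Finset.erase_eq_of_notMem (s := (u :: t).toFinset)]
      exact fun hv => htG v (List.mem_toFinset.1 hv) h.root_mem
    have hdisj : Disjoint (σ.gray.erase v) (u :: t).toFinset := by
      rw [Finset.disjoint_left]
      exact fun c hc hc' => htG c (List.mem_toFinset.1 hc') (Finset.mem_of_mem_erase hc)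
    have h4 : (((σ.gray ∪ (u :: t).toFinset).erase v).filter
        fun c => (S' c).getLast? = some x).card =
        ((σ.gray.erase v).filter fun c => (σ.stack c).getLast? = some x).card +
        (u :: t).countP fun c => (S' c).getLast? = some x := by
      rw [h3, Finset.filter_union, Finset.card_union_of_disjoint
        (Finset.disjoint_filter_filter hdisj)]
      congr 1
      · congr 1
        refine Finset.filter_congr fun c hc => ?_
        rw [hSG c (Finset.mem_of_mem_erase hc)]
      · rw [List.countP_eq_length_filter, ← List.toFinset_card_of_nodup (hnd.filter _)]
        congr 1
        ext c
        simp
    have h5 : (if x ∈ (σ.gray ∪ (u :: t).toFinset).erase v then 1 else 0) =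
        (if x ∈ σ.gray.erase v then 1 else 0) + (u :: t).count x := by
      rw [h3, hnd.count]
      by_cases hx : x ∈ σ.gray.erase v
      · have : x ∉ u :: t := fun hx' => htG x hx' (Finset.mem_of_mem_erase hx)
        rw [if_pos (Finset.mem_union_left _ hx), if_pos hx, if_neg this]
      · simp only [Finset.mem_union, hx, false_or, List.mem_toFinset, if_false, zero_add]
    have h6 : (S' x).length = (σ.stack x).length + if u = x then 1 else 0 := by
      by_cases hx : u = x
      · subst hx; simp [hS']
      · rw [hS x (Ne.symm hx)]; simp [hx]
    rw [← hS'] at h1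
    simp only [List.count_append, List.count_singleton, beq_iff_eq] at h1
    rw [ht] at hb
    rw [List.getLast?_cons_cons] at h2
    simp only [List.head?_cons, Option.some.injEq] at hb
    dsimp only
    rw [h4, h5, h6, getLast?_nextTrail]
    omega

theorem inv_step_of_notMem [Fintype V] {order : List V} {v : V} {σ : State V} (h : Inv order v σ)
    {u : V} {t : List V} (ht : σ.trail = u :: t) {w : V} (hw : w ∉ σ.gray) :
    Inv order v (σ.step order w) := by
  have huG : u ∉ σ.gray := h.notMem_gray u (by simp [ht])
  have hnd : (u :: t).Nodup := by rw [← ht]; exact h.nodup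
  have huv : u ≠ v := fun e => huG (e ▸ h.root_mem)
  have hS : ∀ c, c ≠ u → Function.update σ.stack u (σ.stack u ++ [w]) c = σ.stack c :=
    fun c hc => Function.update_of_ne hc _ _
  have hSG : ∀ c ∈ σ.gray, Function.update σ.stack u (σ.stack u ++ [w]) c = σ.stack c :=
    fun c hc => hS c fun e => huG (e ▸ hc)
  have hchain : (u :: t).IsChain fun a b =>
      (Function.update σ.stack u (σ.stack u ++ [w]) b).getLast? = some a := by
    have hc := h.chain
    rw [ht] at hc
    cases t with
    | nil => simp
    | cons b t =>
      rw [List.isChain_cons_cons] at hc ⊢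
      have hub : b ≠ u := by rintro rfl; simp at hnd
      refine ⟨by rw [hS _ hub]; exact hc.1, ?_⟩
      refine hc.2.imp_of_mem_imp fun a c _ hc' hac => ?_
      rw [hS _ (by rintro rfl; exact (List.nodup_cons.1 hnd).1 hc')]
      exact hac
  simp only [State.step, ht, hw, if_false]
  set S' := Function.update σ.stack u (σ.stack u ++ [w]) with hS'
  refine ⟨h.root_mem, (hS v huv.symm).trans h.stack_root,
    fun c hc => (h.rooted c hc).mono subset_rfl hSG, fun c hc => ?_, ?_, ?_, fun h0 => ?_,
    fun x => ?_⟩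
  · rcases mem_extendTrail hc with rfl | hc
    · exact hw
    · exact h.notMem_gray c (by rwa [ht])
  · rcases extendTrail_cases w (u :: t) with ⟨hn, he⟩ | ⟨l₁, l₂, h1, he⟩
    · simp only [he]; exact List.nodup_cons.2 ⟨hn, hnd⟩
    · simp only [he]; rw [h1] at hnd; exact hnd.of_append_right
  · rcases extendTrail_cases w (u :: t) with ⟨hn, he⟩ | ⟨l₁, l₂, h1, he⟩
    · simp only [he]
      rw [List.isChain_cons_cons]
      exact ⟨by simp [hS'], hchain⟩
    · simp only [he]; rw [h1] at hchain; exact hchain.right_of_append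
  · have := head?_extendTrail w (u :: t)
    simp only at h0
    rw [h0] at this
    simp at this
  · have hb := h.balance x
    have h1 := sum_apply_update (fun _ => List.count x) σ.stack u (σ.stack u ++ [w])
    have h4 : ((σ.gray.erase v).filter fun c => (S' c).getLast? = some x) =
        (σ.gray.erase v).filter fun c => (σ.stack c).getLast? = some x := by
      refine Finset.filter_congr fun c hc => ?_
      rw [hSG c (Finset.mem_of_mem_erase hc)]
    have h6 : (S' x).length = (σ.stack x).length + if u = x then 1 else 0 := by
      by_cases hx : u = x
      · subst hx; simp [hS']
      · rw [hS x (Ne.symm hx)]; simp [hx]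
    rw [← hS'] at h1
    simp only [List.count_append, List.count_singleton, beq_iff_eq] at h1
    rw [ht] at hb
    simp only [List.head?_cons, Option.some.injEq] at hb
    rw [h4, h6, getLast?_extendTrail, head?_extendTrail]
    simp only [Option.some.injEq]
    omega

theorem inv_step [Fintype V] {order : List V} {v : V} {σ : State V} (h : Inv order v σ) (w : V) :
    Inv order v (σ.step order w) := by
  cases ht : σ.trail with
  | nil => simpa only [State.step, ht] using h
  | cons u t =>
    by_cases hw : w ∈ σ.gray
    · exact inv_step_of_mem h ht hw
    · exact inv_step_of_notMem h ht hw

theorem length_stack_step (order : List V) (σ : State V) (w s : V) :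
    ((σ.step order w).stack s).length =
      (σ.stack s).length + if σ.trail.head? = some s then 1 else 0 := by
  cases ht : σ.trail with
  | nil => simp [State.step, ht]
  | cons u t =>
    have : (σ.step order w).stack = Function.update σ.stack u (σ.stack u ++ [w]) := by
      simp only [State.step, ht]; split_ifs <;> rfl
    rw [this]
    by_cases hx : u = s
    · subst hx; simp
    · simp [hx, Function.update_of_ne (Ne.symm hx)]

end Deterministic

/-! ### Reading off a path from the final stacks -/

section ReadPath

variable {V : Type*} [DecidableEq V]

theorem exists_readPath_eq_cons (v : V) (n : ℕ) (S : V → List V) (s : V) :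
    ∃ l, readPath v n S s = s :: l := by
  cases n with
  | zero => exact ⟨[], rfl⟩
  | succ n =>
    unfold readPath
    split_ifs
    · exact ⟨[], rfl⟩
    · cases S s with
      | nil => exact ⟨[], rfl⟩
      | cons w r => exact ⟨_, rfl⟩

theorem notMem_dropLast_readPath (v : V) (n : ℕ) (S : V → List V) (s : V) :
    v ∉ (readPath v n S s).dropLast := by
  induction n generalizing S s with
  | zero => simp [readPath]
  | succ n ih =>
    unfold readPath
    split_ifs with h
    · simp
    · cases S s with
      | nil => simp
      | cons w r =>
        obtain ⟨l, hl⟩ := exists_readPath_eq_cons v n (Function.update S s r) w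
        have := ih (Function.update S s r) w
        simp only [hl] at this ⊢
        rw [List.dropLast_cons_cons, List.mem_cons, not_or]
        exact ⟨Ne.symm h, this⟩

theorem pathStacks_readPath_prefix (v : V) (n : ℕ) (S : V → List V) (s u : V) :
    pathStacks (readPath v n S s) u <+: S u := by
  induction n generalizing S s with
  | zero => simp [readPath, pathStacks]
  | succ n ih =>
    unfold readPath
    split_ifs with h
    · simp [pathStacks]
    · cases hs : S s with
      | nil => simp [pathStacks]
      | cons w r =>
        obtain ⟨l, hl⟩ := exists_readPath_eq_cons v n (Function.update S s r) w
        have := ih (Function.update S s r) w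
        simp only [hl] at this ⊢
        simp only [pathStacks]
        by_cases hu : u = s
        · subst hu
          rw [Function.update_self] at this ⊢
          rw [hs]
          exact (List.prefix_cons_inj w).2 this
        · rwa [Function.update_of_ne hu] at this ⊢

/-- With fuel at least the total number of entries, the fuel can only run out when all stacks are
empty, so the reading is never cut short. -/
theorem readPath_end [Fintype V] (v : V) (n : ℕ) (S : V → List V) (s : V)
    (hn : ∑ u, (S u).length ≤ n) {e : V} (he : (readPath v n S s).getLast? = some e) :
    e = v ∨ pathStacks (readPath v n S s) e = S e := by
  induction n generalizing S s with
  | zero =>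
    right
    have : ∑ u, (S u).length = 0 := by omega
    rw [Finset.sum_eq_zero_iff] at this
    rw [List.length_eq_zero_iff.1 (this e (Finset.mem_univ e))]
    rfl
  | succ n ih =>
    unfold readPath at he ⊢
    split_ifs at he ⊢ with h
    · left
      simp only [List.getLast?_singleton, Option.some.injEq] at he
      rw [← he, h]
    · cases hs : S s with
      | nil =>
        right
        simp only [hs, List.getLast?_singleton, Option.some.injEq] at he
        rw [← he, hs]
        rfl
      | cons w r =>
        have h1 := sum_apply_update (fun _ => List.length) S s r
        obtain ⟨l, hl⟩ := exists_readPath_eq_cons v n (Function.update S s r) w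
        have := ih (Function.update S s r) w (by
          simp only [hs, List.length_cons] at h1; omega)
        simp only [hs, hl] at this he ⊢
        rw [List.getLast?_cons_cons] at he
        refine (this he).imp id fun h2 => ?_
        simp only [pathStacks]
        by_cases hu : e = s
        · subst hu
          rw [Function.update_self] at h2 ⊢
          rw [hs, h2]
        · rwa [Function.update_of_ne hu] at h2 ⊢

/-- Counting argument: if stacks `S` consist of a tree directed to `v` on top of balanced entries,
then any path that uses up a bottom part `T` of them and cannot be continued ends at `v`, and it
exhausts the stack of its starting point. -/
theorem end_eq_root_and_start_exhausted [Fintype V] {v s e : V} {S T : V → List V} (hs : s ≠ v)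
    (hSv : S v = [])
    (hroot : ∀ u, Rooted v S Finset.univ u)
    (hbal : ∀ x, ∑ c, (S c).count x + (if x ≠ v then 1 else 0) = (S x).length +
      ((Finset.univ.erase v).filter fun c => (S c).getLast? = some x).card)
    (hT : ∀ u, T u <+: S u)
    (hpath : ∀ x, (T x).length + (if e = x then 1 else 0) =
      ∑ c, (T c).count x + (if s = x then 1 else 0))
    (he : e = v ∨ T e = S e) : e = v ∧ T s = S s := by
  -- `F` is the set of exhausted non-root vertices. The top of a stack that is not exhausted is not
  -- among the used entries, so in the balance of `S` only tops of vertices of `F` need be kept.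
  set F : Finset V := (Finset.univ.erase v).filter fun u => T u = S u with hF
  have hvF : v ∉ F := by simp [hF]
  have key : ∀ x, ∑ c, (T c).count x + (if x ≠ v then 1 else 0) ≤ (S x).length +
      (F.filter fun c => (S c).getLast? = some x).card := by
    intro x
    have h1 : ∑ c, (T c).count x + (((Finset.univ.erase v).filter fun c => ¬ T c = S c).filter
        fun c => (S c).getLast? = some x).card ≤ ∑ c, (S c).count x := by
      rw [Finset.card_filter, Finset.sum_filter, ← Finset.sum_erase_add _ _ (Finset.mem_univ v),
        ← Finset.sum_erase_add (a := v) _ (fun c => (S c).count x) (Finset.mem_univ v),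
        add_right_comm, ← Finset.sum_add_distrib]
      refine add_le_add (Finset.sum_le_sum fun c _ => ?_) ((hT v).sublist.count_le x)
      obtain ⟨r, hr⟩ := hT c
      rw [← hr, List.count_append]
      split_ifs with hc hx
      · simp
      · cases r with
        | nil => simp at hc
        | cons a r =>
          rw [List.getLast?_append_of_ne_nil _ (by simp)] at hx
          have := List.count_pos_iff.2 (List.mem_of_getLast? hx)
          omega
      · simp
    have h2 : ((Finset.univ.erase v).filter fun c => (S c).getLast? = some x).card =
        (F.filter fun c => (S c).getLast? = some x).card +
        (((Finset.univ.erase v).filter fun c => ¬ T c = S c).filter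
        fun c => (S c).getLast? = some x).card := by
      rw [hF, Finset.filter_comm, Finset.filter_comm (fun c => ¬ T c = S c),
        Finset.card_filter_add_card_filter_not]
    have := hbal x
    omega
  have hTv : T v = [] := List.prefix_nil.1 (hSv ▸ hT v)
  have heF : e ≠ v → e ∈ F := fun h => by
    simp only [hF, Finset.mem_filter, Finset.mem_erase, Finset.mem_univ, and_true]
    exact ⟨h, he.resolve_left h⟩
  -- A path from `s ≠ v` to `v` uses an entry equal to `v`, whereas `key v` with `F` empty allows
  -- none. A path stuck elsewhere exhausts its endpoint.
  have hne : F.Nonempty := by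
    by_cases hev : e = v
    · by_contra h0
      rw [Finset.not_nonempty_iff_eq_empty] at h0
      have h1 := key v
      have h2 := hpath v
      rw [h0] at h1
      simp [hSv] at h1
      rw [if_pos hev, if_neg hs, hTv] at h2
      simp [h1] at h2
    · exact ⟨e, heF hev⟩
  obtain ⟨c₀, hc₀, hc₀'⟩ : ∃ c ∈ F, ∀ w ∈ F, (S c).getLast? ≠ some w := by
    obtain ⟨u, hu⟩ := hne
    exact (hroot u).exists_top_notMem hvF hu
  have hsum : ∑ x ∈ F, (1 + if e = x then 1 else 0) ≤
      ∑ x ∈ F, ((if s = x then 1 else 0) + (F.filter fun c => (S c).getLast? = some x).card) := by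
    refine Finset.sum_le_sum fun x hx => ?_
    have h1 := key x
    have h2 := hpath x
    simp only [hF, Finset.mem_filter, Finset.mem_erase, Finset.mem_univ, and_true] at hx
    rw [if_pos hx.1, ← hx.2] at h1
    omega
  -- Each vertex of `F` has only one top, and that of `c₀` lies outside `F`. Together with `hsum`
  -- this gives `[e ∈ F] + 1 ≤ [s ∈ F]`, so `s ∈ F` and `e ∉ F`.
  have hlt : ∑ x ∈ F, (F.filter fun c => (S c).getLast? = some x).card + 1 ≤ F.card := by
    simp only [Finset.card_filter]
    rw [Finset.sum_comm, Finset.card_eq_sum_ones, ← Finset.sum_erase_add _ _ hc₀,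
      ← Finset.sum_erase_add (a := c₀) _ (fun _ => 1) hc₀]
    have h0 : ∑ x ∈ F, (if (S c₀).getLast? = some x then 1 else 0) = 0 :=
      Finset.sum_eq_zero fun x hx => if_neg (hc₀' x hx)
    rw [h0, add_zero]
    refine add_le_add (Finset.sum_le_sum fun c _ => ?_) le_rfl
    rw [← Finset.card_filter]
    refine Finset.card_le_one.2 fun a ha b hb => ?_
    simp only [Finset.mem_filter] at ha hb
    exact Option.some.inj (ha.2.symm.trans hb.2)
  rw [Finset.sum_add_distrib, Finset.sum_add_distrib, Finset.sum_ite_eq, Finset.sum_ite_eq,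
    ← Finset.card_eq_sum_ones] at hsum
  have hsF : s ∈ F := by
    by_contra h
    rw [if_neg h] at hsum
    omega
  refine ⟨?_, (Finset.mem_filter.1 hsF).2⟩
  by_contra h
  rw [if_pos hsF, if_pos (heF h)] at hsum
  omega

/-- What the loop-included path from `s` looks like if `S` are the final stacks of a run. -/
structure IsCompletePath (v : V) (S : V → List V) (s : V) (γ : List V) : Prop where
  head? : γ.head? = some s
  getLast? : γ.getLast? = some v
  notMem_dropLast : v ∉ γ.dropLast
  prefix_stack : ∀ u, pathStacks γ u <+: S u
  count_le : ∀ u, u ≠ v → γ.count u ≤ (S u).length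
  count_start : s ≠ v → γ.count s = (S s).length

theorem Inv.isCompletePath [Fintype V] {order : List V} {v : V} {σ : State V}
    (h : Inv order v σ) (hmem : ∀ u, u ∈ order ↔ u ≠ v) (htrail : σ.trail = []) (s : V) :
    IsCompletePath v σ.stack s (loopIncludedPath v σ.stack s) := by
  obtain ⟨l, hl⟩ := exists_readPath_eq_cons v (∑ u, (σ.stack u).length) σ.stack s
  have hgray : σ.gray = Finset.univ := by
    refine Finset.eq_univ_of_forall fun u => ?_
    by_cases hu : u = v
    · exact hu ▸ h.root_mem
    · exact h.stopped htrail u ((hmem u).2 hu)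
  have hpre := pathStacks_readPath_prefix v (∑ u, (σ.stack u).length) σ.stack s
  obtain ⟨e, he⟩ : ∃ e, (s :: l).getLast? = some e := ⟨_, List.getLast?_eq_some_getLast (by simp)⟩
  have hend := readPath_end v _ σ.stack s le_rfl (hl ▸ he)
  have hdrop := notMem_dropLast_readPath v (∑ u, (σ.stack u).length) σ.stack s
  have hlen := fun x => length_pathStacks x s l
  have hsum := fun x => sum_count_pathStacks x s l
  rw [he] at hlen
  unfold loopIncludedPath
  rw [hl] at hpre hend hdrop ⊢
  have hmain : e = v ∧ (s ≠ v → pathStacks (s :: l) s = σ.stack s) := by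
    by_cases hs : s = v
    · refine ⟨?_, fun h => absurd hs h⟩
      cases l with
      | nil => simpa [hs, eq_comm] using he
      | cons a l => simp [hs] at hdrop
    · have := end_eq_root_and_start_exhausted hs h.stack_root
        (fun u => hgray ▸ h.rooted u (hgray ▸ Finset.mem_univ u)) (fun x => ?_) hpre
        (fun x => ?_) hend
      · exact ⟨this.1, fun _ => this.2⟩
      · have := h.balance x
        simpa [htrail, hgray] using this
      · have h1 := hlen x
        have h2 := hsum x
        simp only [Option.some.injEq] at h1
        omega
  obtain ⟨rfl, hexh⟩ := hmain
  have hcount : ∀ u, u ≠ e → (s :: l).count u = (pathStacks (s :: l) u).length := fun u hu => by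
    rw [← hlen u, if_neg (by simpa using Ne.symm hu), add_zero]
  refine ⟨rfl, he, hdrop, hpre, fun u hu => ?_, fun hs => ?_⟩
  · rw [hcount u hu]; exact (hpre u).length_le
  · rw [hcount s hs, hexh hs]

end ReadPath

/-! ### Markov property and drift inequalities from the product formula -/

section MarkovChain

open MeasureTheory
open scoped ENNReal

variable {Ω S : Type*} [MeasurableSpace Ω] {μ : Measure Ω} {p : S → PMF S} {x₀ : S}
  {X : ℕ → Ω → S}

theorem IsMarkovChain.measurable [Countable S] [MeasurableSpace S] [DiscreteMeasurableSpace S]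
    (hX : IsMarkovChain μ p x₀ X) (n : ℕ) : Measurable (X n) :=
  measurable_to_countable' fun x => hX.measurableSet n x

theorem IsMarkovChain.measure_history_succ (hX : IsMarkovChain μ p x₀ X) (n : ℕ)
    (z : Fin (n + 1) → S) (x y : S) :
    μ ((fun ω (i : Fin (n + 1)) => X i ω) ⁻¹' {z} ∩ {ω | X n ω = x ∧ X (n + 1) ω = y}) =
      μ ((fun ω (i : Fin (n + 1)) => X i ω) ⁻¹' {z} ∩ {ω | X n ω = x}) * p x y := by
  by_cases h0 : z 0 = x₀
  swap
  · have hnull : μ ((fun ω (i : Fin (n + 1)) => X i ω) ⁻¹' {z}) = 0 := by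
      refine measure_mono_null (fun ω hω => ?_) (ae_iff.1 hX.start)
      intro h
      refine h0 ?_
      rw [← h, ← (show _ = z from hω)]
      rfl
    rw [measure_mono_null Set.inter_subset_left hnull,
      measure_mono_null Set.inter_subset_left hnull, zero_mul]
  by_cases hx : z (Fin.last n) = x
  swap
  · have h1 : ∀ ω, (fun i : Fin (n + 1) => X i ω) = z → X n ω ≠ x := fun ω hω h => hx (by
      rw [← h, ← hω]; rfl)
    have e1 : (fun ω (i : Fin (n + 1)) => X i ω) ⁻¹' {z} ∩ {ω | X n ω = x} = ∅ := by
      ext ω; simpa using h1 ω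
    have e2 : (fun ω (i : Fin (n + 1)) => X i ω) ⁻¹' {z} ∩ {ω | X n ω = x ∧ X (n + 1) ω = y} =
        ∅ := by
      rw [← Set.subset_empty_iff, ← e1]
      exact Set.inter_subset_inter_right _ fun ω h => h.1
    rw [e1, e2]; simp
  -- The history `z` followed by `y`; the values beyond index `n + 1` play no role.
  set q : ℕ → S := fun i => if h : i < n + 1 then z ⟨i, h⟩ else y with hq
  have hqn : q n = x := by rw [hq]; simp only [Nat.lt_succ_self, dif_pos]; exact hx
  have hqn1 : q (n + 1) = y := by simp [hq]
  have hq0 : q 0 = x₀ := by rw [hq]; simp only [Nat.succ_pos, dif_pos]; exact h0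
  have hz : ∀ ω, (fun i : Fin (n + 1) => X i ω) = z ↔ ∀ i ≤ n, X i ω = q i := by
    intro ω
    rw [funext_iff, Fin.forall_iff]
    refine forall_congr' fun i => ⟨fun h hi => ?_, fun h hi => ?_⟩
    · simpa [hq, hi] using h (Nat.lt_succ_of_le hi)
    · simpa [hq, Nat.le_of_lt_succ hi] using h (Nat.le_of_lt_succ hi)
  have e1 : (fun ω (i : Fin (n + 1)) => X i ω) ⁻¹' {z} ∩ {ω | X n ω = x} =
      {ω | ∀ i ≤ n, X i ω = q i} := by
    ext ω
    simp only [Set.mem_inter_iff, Set.mem_preimage, Set.mem_singleton_iff, hz, Set.mem_ofPred_eq]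
    exact ⟨fun h => h.1, fun h => ⟨h, (h n le_rfl).trans hqn⟩⟩
  have e2 : (fun ω (i : Fin (n + 1)) => X i ω) ⁻¹' {z} ∩ {ω | X n ω = x ∧ X (n + 1) ω = y} =
      {ω | ∀ i ≤ n + 1, X i ω = q i} := by
    ext ω
    simp only [Set.mem_inter_iff, Set.mem_preimage, Set.mem_singleton_iff, hz, Set.mem_ofPred_eq]
    constructor
    · rintro ⟨h, -, h'⟩ i hi
      rcases Nat.le_succ_iff.1 hi with hi | rfl
      · exact h i hi
      · rw [h', hqn1]
    · intro h
      exact ⟨fun i hi => h i (by omega), (h n (by omega)).trans hqn, (h _ le_rfl).trans hqn1⟩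
  rw [e1, e2, hX.history _ _ hq0, hX.history _ _ hq0, Finset.prod_range_succ, hqn, hqn1]

theorem IsMarkovChain.lintegral_zero (hX : IsMarkovChain μ p x₀ X) (f : S → ℝ≥0∞) :
    ∫⁻ ω, f (X 0 ω) ∂μ = f x₀ := by
  have := hX.isProbabilityMeasure
  rw [lintegral_congr_ae (g := fun _ => f x₀), lintegral_const, measure_univ, mul_one]
  filter_upwards [hX.start] with ω hω
  rw [hω]

variable [Countable S]

/-- Sum `measure_history_succ` over the countably many histories. -/
theorem IsMarkovChain.measure_pair (hX : IsMarkovChain μ p x₀ X) (n : ℕ) (x y : S) :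
    μ {ω | X n ω = x ∧ X (n + 1) ω = y} = μ {ω | X n ω = x} * p x y := by
  let : MeasurableSpace S := ⊤
  have hm := hX.measurable
  have hH : Measurable fun ω (i : Fin (n + 1)) => X i ω := measurable_pi_lambda _ fun i => hm i
  have key : ∀ A : Set Ω, MeasurableSet A →
      ∑' z, μ ((fun ω (i : Fin (n + 1)) => X i ω) ⁻¹' {z} ∩ A) = μ A := by
    intro A hA
    have := tsum_measure_preimage_singleton (μ := μ.restrict A) (f := fun ω (i : Fin (n + 1)) =>
      X i ω) (s := Set.univ) Set.countable_univ (fun z _ => hH (measurableSet_singleton z))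
    rw [tsum_univ fun z => μ.restrict A ((fun ω (i : Fin (n + 1)) => X i ω) ⁻¹' {z})] at this
    rw [Set.preimage_univ, Measure.restrict_apply_univ] at this
    rw [← this]
    exact tsum_congr fun z => (Measure.restrict_apply (hH (measurableSet_singleton z))).symm
  have m1 : MeasurableSet {ω | X n ω = x} := hX.measurableSet n x
  rw [← key _ m1, ← key {ω | X n ω = x ∧ X (n + 1) ω = y}
    (m1.inter (hX.measurableSet (n + 1) y)), ← ENNReal.tsum_mul_right]
  exact tsum_congr fun z => hX.measure_history_succ n z x y

theorem IsMarkovChain.ae_mem_support (hX : IsMarkovChain μ p x₀ X) :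
    ∀ᵐ ω ∂μ, ∀ n, p (X n ω) (X (n + 1) ω) ≠ 0 := by
  have : ∀ n x y, ∀ᵐ ω ∂μ, p x y = 0 → ¬ (X n ω = x ∧ X (n + 1) ω = y) := by
    intro n x y
    by_cases h : p x y = 0
    · have := hX.measure_pair n x y
      rw [h, mul_zero] at this
      filter_upwards [measure_eq_zero_iff_ae_notMem.1 this] with ω hω _
      exact hω
    · exact .of_forall fun ω h' => absurd h' h
  simp only [← ae_all_iff] at this
  filter_upwards [this] with ω hω n h
  exact hω n _ _ h ⟨rfl, rfl⟩

theorem IsMarkovChain.lintegral_succ (hX : IsMarkovChain μ p x₀ X) (n : ℕ) (f : S → ℝ≥0∞) :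
    ∫⁻ ω, f (X (n + 1) ω) ∂μ = ∫⁻ ω, ∑' y, p (X n ω) y * f y ∂μ := by
  let : MeasurableSpace S := ⊤
  have hm := hX.measurable
  have h1 : ∀ g : S → ℝ≥0∞, ∫⁻ ω, g (X n ω) ∂μ = ∑' x, g x * μ {ω | X n ω = x} := by
    intro g
    rw [← lintegral_map (f := g) (measurable_of_countable _) (hm n), lintegral_countable']
    refine tsum_congr fun x => ?_
    rw [Measure.map_apply (hm n) (measurableSet_singleton x)]
    rfl
  have h2 : ∫⁻ ω, f (X (n + 1) ω) ∂μ =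
      ∑' z : S × S, f z.2 * μ {ω | X n ω = z.1 ∧ X (n + 1) ω = z.2} := by
    have hp : Measurable fun ω => (X n ω, X (n + 1) ω) := (hm n).prodMk (hm (n + 1))
    rw [← lintegral_map (f := fun z : S × S => f z.2) (measurable_of_countable _) hp,
      lintegral_countable']
    refine tsum_congr fun x => ?_
    rw [Measure.map_apply hp (measurableSet_singleton x)]
    congr 2
    ext ω
    simp [Prod.ext_iff]
  rw [h1 fun x => ∑' y, p x y * f y, h2, ENNReal.tsum_prod']
  refine tsum_congr fun x => ?_
  rw [← ENNReal.tsum_mul_right]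
  refine tsum_congr fun y => ?_
  rw [hX.measure_pair]
  ring

/-- The drift condition is asked only almost surely along the chain, since for Wilson's algorithm it
relies on `Inv`, which fails for arbitrary states. -/
theorem IsMarkovChain.sum_lintegral_add_le (hX : IsMarkovChain μ p x₀ X) {f g : S → ℝ≥0∞}
    (h : ∀ n, ∀ᵐ ω ∂μ, g (X n ω) + ∑' y, p (X n ω) y * f y ≤ f (X n ω)) (n : ℕ) :
    ∑ i ∈ Finset.range n, ∫⁻ ω, g (X i ω) ∂μ + ∫⁻ ω, f (X n ω) ∂μ ≤ f x₀ := by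
  let : MeasurableSpace S := ⊤
  induction n with
  | zero => simp [hX.lintegral_zero]
  | succ n ih =>
    refine le_trans ?_ ih
    rw [Finset.sum_range_succ, add_assoc, hX.lintegral_succ, ← lintegral_add_left
      (f := fun ω => g (X n ω)) ((measurable_of_countable g).comp (hX.measurable n))]
    exact add_le_add le_rfl (lintegral_mono_ae (h n))

/-- A nonnegative function that decreases by at least `g` on average along the chain bounds the
expected total of `g`. -/
theorem IsMarkovChain.lintegral_tsum_le (hX : IsMarkovChain μ p x₀ X) {f g : S → ℝ≥0∞}
    (h : ∀ n, ∀ᵐ ω ∂μ, g (X n ω) + ∑' y, p (X n ω) y * f y ≤ f (X n ω)) :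
    ∫⁻ ω, ∑' n, g (X n ω) ∂μ ≤ f x₀ := by
  let : MeasurableSpace S := ⊤
  rw [lintegral_tsum (f := fun n ω => g (X n ω))
    fun n => ((measurable_of_countable g).comp (hX.measurable n)).aemeasurable]
  refine ENNReal.tsum_le_of_sum_range_le fun n => ?_
  exact le_trans (self_le_add_right _ _) (hX.sum_lintegral_add_le h n)

theorem IsMarkovChain.lintegral_le (hX : IsMarkovChain μ p x₀ X) {f : S → ℝ≥0∞}
    (h : ∀ x, ∑' y, p x y * f y ≤ f x) (n : ℕ) : ∫⁻ ω, f (X n ω) ∂μ ≤ f x₀ := by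
  have := hX.sum_lintegral_add_le (f := f) (g := 0) (fun n => .of_forall fun ω => by
    simpa using h (X n ω)) n
  simpa using this

end MarkovChain

/-! ### The reduced Laplacian: invertibility, columns of the inverse, hitting times -/

section Laplacian

open scoped ENNReal Matrix

variable {V : Type*} [Fintype V] [DecidableEq V] {G : SimpleGraph V} [DecidableRel G.Adj] {v : V}

omit [DecidableEq V] in
theorem degree_ne_zero (hG : G.Connected) {u : V} (hu : u ≠ v) : G.degree u ≠ 0 := by
  have : Nontrivial V := ⟨u, v, hu⟩
  exact (hG.preconnected.degree_pos_of_nontrivial u).ne'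

theorem reducedLaplacian_mulVec (x : V → ℝ) (hx : x v = 0) (s : {u : V // u ≠ v}) :
    (reducedLaplacian G v *ᵥ fun u => x u) s =
      G.degree s * x s - ∑ w ∈ G.neighborFinset s, x w := by
  rw [← G.lapMatrix_mulVec_apply, Matrix.mulVec, Matrix.mulVec, dotProduct, dotProduct]
  simp only [reducedLaplacian, Matrix.submatrix_apply]
  rw [← Finset.sum_subtype (Finset.univ.erase v) (by simp) fun w => G.lapMatrix ℝ s w * x w]
  exact Finset.sum_erase _ (by rw [hx, mul_zero])

/-- Extension of a vector by zero at the root. -/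
def extendByZero (v : V) (x : {u : V // u ≠ v} → ℝ) (u : V) : ℝ :=
  if h : u ≠ v then x ⟨u, h⟩ else 0

omit [Fintype V] in
theorem extendByZero_root (x : {u : V // u ≠ v} → ℝ) : extendByZero v x v = 0 := by
  simp [extendByZero]

omit [Fintype V] in
theorem extendByZero_coe (x : {u : V // u ≠ v} → ℝ) :
    (fun u : {u : V // u ≠ v} => extendByZero v x u) = x := by
  ext u
  simp [extendByZero, u.2]

/-- A kernel vector, extended by zero at `v`, has zero Dirichlet energy. It is therefore constant on
the connected graph, and the constant is its value 0 at `v`. -/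
theorem isUnit_reducedLaplacian (hG : G.Connected) (v : V) : IsUnit (reducedLaplacian G v) := by
  rw [← Matrix.mulVec_injective_iff_isUnit, ← Matrix.coe_mulVecLin, injective_iff_map_eq_zero]
  intro x hx
  rw [Matrix.mulVecLin_apply] at hx
  set y := extendByZero v x with hy
  have hyv : y v = 0 := extendByZero_root x
  have hL : ∀ u, u ≠ v → (G.lapMatrix ℝ *ᵥ y) u = 0 := by
    intro u hu
    rw [G.lapMatrix_mulVec_apply, ← reducedLaplacian_mulVec y hyv ⟨u, hu⟩, extendByZero_coe, hx]
    rfl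
  have hq : Matrix.toLinearMap₂' ℝ (G.lapMatrix ℝ) y y = 0 := by
    rw [Matrix.toLinearMap₂'_apply', dotProduct]
    refine Finset.sum_eq_zero fun u _ => ?_
    by_cases hu : u = v
    · rw [hu, hyv, zero_mul]
    · rw [hL u hu, mul_zero]
  rw [G.lapMatrix_toLinearMap₂'_apply'_eq_zero_iff_forall_reachable] at hq
  have h0 : ∀ u, y u = 0 := fun u => (hq u v (hG.preconnected u v)).trans hyv
  rw [← extendByZero_coe x]
  ext u
  exact h0 u

theorem inv_reducedLaplacian_apply (hG : G.Connected) (x : V → ℝ) (hx : x v = 0)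
    (u : {u : V // u ≠ v})
    (h : ∀ s, s ≠ v → G.degree s * x s = (if s = u then (G.degree s : ℝ) else 0) +
      ∑ w ∈ G.neighborFinset s, x w) (s : {u : V // u ≠ v}) :
    (reducedLaplacian G v)⁻¹ s u = x s / G.degree u := by
  have hdet := (Matrix.isUnit_iff_isUnit_det _).1 (isUnit_reducedLaplacian hG v)
  have hd : (G.degree (u : V) : ℝ) ≠ 0 := by exact_mod_cast degree_ne_zero hG u.2
  have h1 : (reducedLaplacian G v *ᵥ fun u => x u) = Pi.single u (G.degree u : ℝ) := by
    ext s
    rw [reducedLaplacian_mulVec x hx, h s s.2, add_sub_cancel_right]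
    by_cases hsu : s = u
    · subst hsu; simp
    · rw [Pi.single_eq_of_ne hsu, if_neg fun h => hsu (Subtype.ext h)]
  have h2 : (fun u : {u : V // u ≠ v} => x u) =
      (reducedLaplacian G v)⁻¹ *ᵥ Pi.single u (G.degree u : ℝ) := by
    rw [← h1, Matrix.mulVec_mulVec, Matrix.nonsing_inv_mul _ hdet, Matrix.one_mulVec]
  rw [eq_div_iff hd, show x s = (fun u : {u : V // u ≠ v} => x u) s from rfl, h2]
  simp

theorem exists_hittingTime (hG : G.Connected) (v : V) : ∃ h : V → ℝ, (∀ u, 0 ≤ h u) ∧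
    ∀ u, u ≠ v → G.degree u * h u = G.degree u + ∑ w ∈ G.neighborFinset u, h w := by
  have hdet := (Matrix.isUnit_iff_isUnit_det _).1 (isUnit_reducedLaplacian hG v)
  set x := (reducedLaplacian G v)⁻¹ *ᵥ fun u => (G.degree u : ℝ) with hx
  set h := extendByZero v x with hh
  have hrec : ∀ u, u ≠ v → G.degree u * h u = G.degree u + ∑ w ∈ G.neighborFinset u, h w := by
    intro u hu
    have h1 := reducedLaplacian_mulVec (G := G) h (extendByZero_root x) ⟨u, hu⟩
    rw [extendByZero_coe, hx, Matrix.mulVec_mulVec, Matrix.mul_nonsing_inv _ hdet,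
      Matrix.one_mulVec] at h1
    linarith
  refine ⟨h, fun u => ?_, hrec⟩
  -- Minimum principle: at a minimum `m ≠ v` the neighbour sum is at least `d_m h(m)`, so the
  -- recursion would force `d_m ≤ 0`. Hence the minimum is `h(v) = 0`.
  obtain ⟨m, -, hm⟩ := Finset.exists_min_image Finset.univ h ⟨v, Finset.mem_univ v⟩
  have hmv : m = v := by
    by_contra hmv
    have h1 := hrec m hmv
    have h2 : (G.degree m : ℝ) * h m ≤ ∑ w ∈ G.neighborFinset m, h w := by
      have := Finset.card_nsmul_le_sum (G.neighborFinset m) h (h m)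
        fun w _ => hm w (Finset.mem_univ w)
      rwa [nsmul_eq_mul, G.card_neighborFinset_eq_degree] at this
    have h3 : (0 : ℝ) < G.degree m := by
      exact_mod_cast Nat.pos_of_ne_zero (degree_ne_zero hG hmv)
    linarith
  have := hm u (Finset.mem_univ u)
  rwa [hmv, hh, extendByZero_root] at this

theorem randomNeighbor_apply {u : V} (hu : G.degree u ≠ 0) (w : V) :
    randomNeighbor G u w = if w ∈ G.neighborFinset u then (G.degree u : ℝ≥0∞)⁻¹ else 0 := by
  have h : (G.neighborFinset u).Nonempty := by
    rw [← Finset.card_pos, G.card_neighborFinset_eq_degree]; omega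
  rw [randomNeighbor, dif_pos h, PMF.uniformOfFinset_apply, G.card_neighborFinset_eq_degree]
  congr!

theorem sum_randomNeighbor_mul {u : V} (hu : G.degree u ≠ 0) (f : V → ℝ≥0∞) :
    ∑ w, randomNeighbor G u w * f w = (G.degree u : ℝ≥0∞)⁻¹ * ∑ w ∈ G.neighborFinset u, f w := by
  simp only [randomNeighbor_apply hu, ite_mul, zero_mul]
  rw [Finset.sum_ite_mem, Finset.univ_inter, Finset.mul_sum]

theorem exists_hittingTime_ennreal (hG : G.Connected) (v : V) : ∃ h : V → ℝ≥0∞,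
    (∀ u, h u ≠ ∞) ∧ ∀ u, u ≠ v → 1 + ∑ w, randomNeighbor G u w * h w = h u := by
  obtain ⟨h, h0, hrec⟩ := exists_hittingTime hG v
  refine ⟨fun u => ENNReal.ofReal (h u), fun u => ENNReal.ofReal_ne_top, fun u hu => ?_⟩
  have hd := degree_ne_zero hG hu
  have hd' : (G.degree u : ℝ) ≠ 0 := by exact_mod_cast hd
  have hpos : (0 : ℝ) < G.degree u := by exact_mod_cast Nat.pos_of_ne_zero hd
  rw [sum_randomNeighbor_mul hd, ← ENNReal.ofReal_sum_of_nonneg fun w _ => h0 w,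
    ← ENNReal.ofReal_natCast, ← ENNReal.ofReal_inv_of_pos hpos,
    ← ENNReal.ofReal_mul (by positivity), ← ENNReal.ofReal_one,
    ← ENNReal.ofReal_add zero_le_one
      (mul_nonneg (by positivity) (Finset.sum_nonneg fun w _ => h0 w))]
  congr 1
  have := hrec u hu
  field_simp
  linarith

end Laplacian

/-! ### One step of the algorithm: Lyapunov function, prefix martingale, path weights -/

section Drift

open MeasureTheory
open scoped ENNReal

variable {V : Type*} [Fintype V] [DecidableEq V] {G : SimpleGraph V} [DecidableRel G.Adj]

theorem tsum_map_mul {α β : Type*} (p : PMF α) (k : α → β) (f : β → ℝ≥0∞) :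
    ∑' y, p.map k y * f y = ∑' x, p x * f (k x) := by
  simp only [PMF.map_apply, ← ENNReal.tsum_mul_right]
  rw [ENNReal.tsum_comm]
  refine tsum_congr fun x => ?_
  rw [tsum_eq_single (k x) fun y hy => by rw [if_neg hy, zero_mul], if_pos rfl]

theorem tsum_wilson_of_nil {order : List V} {σ : State V} (h : σ.trail = [])
    (f : State V → ℝ≥0∞) : ∑' τ, wilson G order σ τ * f τ = f σ := by
  classical
  simp only [wilson, h]
  rw [tsum_eq_single σ fun τ hτ => by rw [PMF.pure_apply, if_neg hτ, zero_mul]]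
  simp

theorem tsum_wilson_of_cons {order : List V} {σ : State V} {u : V} {t : List V}
    (h : σ.trail = u :: t) (f : State V → ℝ≥0∞) :
    ∑' τ, wilson G order σ τ * f τ = ∑ w, randomNeighbor G u w * f (σ.step order w) := by
  simp only [wilson, h]
  rw [tsum_map_mul, tsum_fintype]

theorem exists_eq_step_of_wilson_ne_zero [Nonempty V] {order : List V} {σ τ : State V}
    (h : wilson G order σ τ ≠ 0) : ∃ w, τ = σ.step order w := by
  rw [← PMF.mem_support_iff] at h
  cases ht : σ.trail with
  | nil =>
    simp only [wilson, ht, PMF.support_pure, Set.mem_singleton_iff] at h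
    exact ⟨Classical.arbitrary V, by rw [h]; simp [State.step, ht]⟩
  | cons u t =>
    simp only [wilson, ht, PMF.support_map] at h
    obtain ⟨w, -, hw⟩ := h
    exact ⟨w, hw.symm⟩

omit [DecidableEq V] in
theorem sum_randomNeighbor (u : V) : ∑ w, randomNeighbor G u w = 1 := by
  rw [← tsum_fintype (L := .unconditional V), PMF.tsum_coe]

omit [Fintype V] in
theorem stack_step {order : List V} {σ : State V} {u : V} {t : List V} (ht : σ.trail = u :: t)
    (w : V) : (σ.step order w).stack = Function.update σ.stack u (σ.stack u ++ [w]) := by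
  simp only [State.step, ht]; split_ifs <;> rfl

/-- A bound for the expected number of further steps, given a bound `h` for the expected time to
reach the root from each vertex. -/
noncomputable def potential (h : V → ℝ≥0∞) (σ : State V) : ℝ≥0∞ :=
  (∑ u, h u) * (σ.grayᶜ.card : ℝ≥0∞) + σ.trail.head?.elim 0 h

/-- When a walk ends, at least one more vertex becomes gray. The released summand `∑ u, h u` pays
for the start of the next walk, wherever it is. -/
theorem potential_step_le (h : V → ℝ≥0∞) {order : List V} {v : V} {σ : State V}
    (hσ : Inv order v σ) {u : V} {t : List V} (ht : σ.trail = u :: t) (w : V) :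
    potential h (σ.step order w) ≤ (∑ u, h u) * (σ.grayᶜ.card : ℝ≥0∞) + h w := by
  by_cases hw : w ∈ σ.gray
  · have hu : u ∈ σ.grayᶜ := Finset.mem_compl.2 (hσ.notMem_gray u (by simp [ht]))
    have hcard : (σ.gray ∪ (u :: t).toFinset)ᶜ.card + 1 ≤ σ.grayᶜ.card := by
      rw [Nat.succ_le_iff]
      refine Finset.card_lt_card (Finset.ssubset_iff_of_subset
        (Finset.compl_subset_compl.2 Finset.subset_union_left) |>.2 ⟨u, hu, by simp⟩)
    have hhead : ∀ l : List V, l.head?.elim 0 h ≤ ∑ u, h u := by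
      rintro (_ | ⟨a, l⟩)
      · simp
      · exact Finset.single_le_sum (f := h) (fun _ _ => zero_le) (Finset.mem_univ a)
    simp only [State.step, ht, hw, if_true, potential]
    refine le_trans (add_le_add le_rfl (hhead _)) (le_trans ?_ (self_le_add_right _ _))
    rw [← mul_add_one]
    gcongr
    exact_mod_cast hcard
  · simp only [State.step, ht, hw, if_false, potential, head?_extendTrail]
    exact le_rfl

theorem potential_drift {h : V → ℝ≥0∞} {v : V}
    (hh : ∀ u, u ≠ v → 1 + ∑ w, randomNeighbor G u w * h w = h u) {order : List V} {σ : State V}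
    (hσ : Inv order v σ) : (if σ.trail = [] then 0 else 1) +
      ∑' τ, wilson G order σ τ * potential h τ ≤ potential h σ := by
  cases ht : σ.trail with
  | nil => rw [tsum_wilson_of_nil ht]; simp
  | cons u t =>
    have huv : u ≠ v := fun e => hσ.notMem_gray u (by simp [ht]) (e ▸ hσ.root_mem)
    rw [tsum_wilson_of_cons ht, if_neg (by simp)]
    calc 1 + ∑ w, randomNeighbor G u w * potential h (σ.step order w)
        ≤ 1 + ∑ w, randomNeighbor G u w * ((∑ u, h u) * (σ.grayᶜ.card : ℝ≥0∞) + h w) := by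
          gcongr with w
          exact potential_step_le h hσ ht w
      _ = potential h σ := by
          simp only [mul_add, Finset.sum_add_distrib]
          rw [← Finset.sum_mul, sum_randomNeighbor, one_mul, add_left_comm, hh u huv]
          simp [potential, ht]

/-- The conditional probability that a stack with bottom entries `l`, completed by independent
entries of law `q`, starts with given entries. -/
noncomputable def prefixProb (q : V → ℝ≥0∞) : List V → List V → ℝ≥0∞
  | [], _ => 1
  | a :: T, [] => q a * prefixProb q T []
  | a :: T, b :: l => if a = b then prefixProb q T l else 0

theorem sum_prefixProb {q : V → ℝ≥0∞} (hq : ∑ w, q w = 1) (T l : List V) :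
    ∑ w, q w * prefixProb q T (l ++ [w]) = prefixProb q T l := by
  induction T generalizing l with
  | nil => simpa [prefixProb] using hq
  | cons a T ih =>
    cases l with
    | nil => simp [prefixProb]
    | cons b l =>
      by_cases hab : a = b
      · simpa [prefixProb, hab] using ih l
      · simp [prefixProb, hab]

omit [Fintype V] in
theorem prefixProb_of_prefix (q : V → ℝ≥0∞) {T l : List V} (h : T <+: l) :
    prefixProb q T l = 1 := by
  obtain ⟨r, rfl⟩ := h
  induction T with
  | nil => rfl
  | cons a T ih => simpa [prefixProb] using ih

/-- The martingale property: a step pushes one random entry on the stack of the current vertex, so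
only one factor changes, and `sum_prefixProb` averages it. -/
theorem tsum_wilson_prod_prefixProb (order : List V) (T : V → List V) (σ : State V) :
    ∑' τ, wilson G order σ τ * ∏ u, prefixProb (randomNeighbor G u) (T u) (τ.stack u) =
      ∏ u, prefixProb (randomNeighbor G u) (T u) (σ.stack u) := by
  cases ht : σ.trail with
  | nil => rw [tsum_wilson_of_nil ht fun τ => ∏ u, prefixProb (randomNeighbor G u) (T u) (τ.stack u)]
  | cons u t =>
    rw [tsum_wilson_of_cons ht fun τ => ∏ u, prefixProb (randomNeighbor G u) (T u) (τ.stack u)]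
    rw [← Finset.mul_prod_erase _ _ (Finset.mem_univ u),
      ← sum_prefixProb (sum_randomNeighbor u), Finset.sum_mul]
    refine Finset.sum_congr rfl fun w _ => ?_
    rw [stack_step ht, ← Finset.mul_prod_erase _ _ (Finset.mem_univ u), Function.update_self,
      mul_assoc]
    congr 2
    refine Finset.prod_congr rfl fun c hc => ?_
    rw [Function.update_of_ne (Finset.ne_of_mem_erase hc)]

/-- The probability that an absorbed random walk follows a given path; it vanishes unless the path
ends with its first visit to `v`. -/
noncomputable def pathWeight (G : SimpleGraph V) [DecidableRel G.Adj] (v : V) : List V → ℝ≥0∞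
  | [] => 0
  | [x] => if x = v then 1 else 0
  | x :: y :: l => if x = v then 0 else randomNeighbor G x y * pathWeight G v (y :: l)

/-- Grouping the steps of a path by their starting vertex does not change the product of their
probabilities. -/
theorem prod_prefixProb_pathStacks {v : V} {γ : List V} (hlast : γ.getLast? = some v)
    (hdrop : v ∉ γ.dropLast) :
    ∏ u, prefixProb (randomNeighbor G u) (pathStacks γ u) [] = pathWeight G v γ := by
  induction γ with
  | nil => simp at hlast
  | cons x l ih =>
    cases l with
    | nil =>
      obtain rfl : x = v := by simpa using hlast
      simp [pathStacks, pathWeight, prefixProb]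
    | cons y l =>
      rw [List.getLast?_cons_cons] at hlast
      rw [List.dropLast_cons_cons, List.mem_cons, not_or] at hdrop
      rw [pathWeight, if_neg (Ne.symm hdrop.1), ← ih hlast hdrop.2,
        ← Finset.mul_prod_erase _ _ (Finset.mem_univ x),
        ← Finset.mul_prod_erase _ (fun u => prefixProb _ (pathStacks (y :: l) u) [])
          (Finset.mem_univ x), ← mul_assoc]
      congr 1
      · simp [pathStacks, prefixProb]
      · refine Finset.prod_congr rfl fun c hc => ?_
        rw [pathStacks, Function.update_of_ne (Finset.ne_of_mem_erase hc)]

end Drift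

/-! ### Pathwise consequences for a run that stops -/

section Runs

variable {V : Type*} [DecidableEq V]

/-- `x` is a run of Wilson's algorithm that stops. -/
structure IsStoppingRun (order : List V) (v : V) (x : ℕ → State V) : Prop where
  start : x 0 = State.init order v
  step : ∀ n, ∃ w, x (n + 1) = (x n).step order w
  terminates : ∃ n, (x n).trail = []

variable {order : List V} {v : V} {x : ℕ → State V}

theorem IsStoppingRun.eq_of_le (h : IsStoppingRun order v x) {N n : ℕ} (hN : (x N).trail = [])
    (hn : N ≤ n) : x n = x N := by
  induction n, hn using Nat.le_induction with
  | base => rfl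
  | succ n _ ih =>
    obtain ⟨w, hw⟩ := h.step n
    rw [hw, ih]
    simp only [State.step, hN]

theorem IsStoppingRun.finalStacks_eq (h : IsStoppingRun order v x) {N : ℕ}
    (hN : (x N).trail = []) : finalStacks x = (x N).stack := by
  classical
  have he : ∃ n, (x n).trail = [] := ⟨N, hN⟩
  rw [finalStacks, dif_pos he, ← h.eq_of_le (Nat.find_spec he) (Nat.find_min' he hN)]

theorem IsStoppingRun.length_stack (h : IsStoppingRun order v x) (s : V) (n : ℕ) :
    ((x n).stack s).length =
      ((Finset.range n).filter fun i => (x i).trail.head? = some s).card := by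
  rw [Finset.card_filter]
  induction n with
  | zero => simp [h.start, State.init]
  | succ n ih =>
    obtain ⟨w, hw⟩ := h.step n
    rw [hw, length_stack_step, ih, Finset.sum_range_succ]

theorem IsStoppingRun.visits_eq (h : IsStoppingRun order v x) (s : V) :
    visits x s = (finalStacks x s).length := by
  obtain ⟨N, hN⟩ := h.terminates
  rw [h.finalStacks_eq hN, h.length_stack, visits, ← Set.ncard_coe_finset]
  congr 1
  ext n
  simp only [Set.mem_ofPred_eq, Finset.coe_filter, Finset.mem_range]
  refine ⟨fun hn => ⟨?_, hn⟩, fun hn => hn.2⟩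
  by_contra hlt
  rw [h.eq_of_le hN (not_lt.1 hlt), hN] at hn
  simp at hn

open scoped ENNReal in
theorem IsStoppingRun.length_finalStacks_le (h : IsStoppingRun order v x) (s : V) :
    ((finalStacks x s).length : ℝ≥0∞) ≤ ∑' n, if (x n).trail = [] then 0 else 1 := by
  obtain ⟨N, hN⟩ := h.terminates
  rw [h.finalStacks_eq hN, h.length_stack, Finset.card_filter]
  push_cast
  refine le_trans (Finset.sum_le_sum fun n _ => ?_) (ENNReal.sum_le_tsum (Finset.range N))
  by_cases hn : (x n).trail = []
  · simp [hn]
  · rw [if_neg hn]; split_ifs <;> simp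

theorem IsStoppingRun.inv [Fintype V] (h : IsStoppingRun order v x) (n : ℕ) :
    Inv order v (x n) := by
  induction n with
  | zero => rw [h.start]; exact inv_init _ _
  | succ n ih =>
    obtain ⟨w, hw⟩ := h.step n
    rw [hw]
    exact inv_step ih w

theorem IsStoppingRun.isCompletePath [Fintype V] (h : IsStoppingRun order v x)
    (hmem : ∀ u, u ∈ order ↔ u ≠ v) (s : V) :
    IsCompletePath v (finalStacks x) s (loopIncludedPath v (finalStacks x) s) := by
  obtain ⟨N, hN⟩ := h.terminates
  rw [h.finalStacks_eq hN]
  exact (h.inv N).isCompletePath hmem hN s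

end Runs

/-! ### Total mass of the path weights -/

section PathWeight

open scoped ENNReal

variable {V : Type*} [Fintype V]

theorem tsum_list (F : List V → ℝ≥0∞) :
    ∑' γ, F γ = F [] + ∑ a, ∑' γ, F (a :: γ) := by
  classical
  have h1 : ∀ γ, F γ = (if γ = [] then F [] else 0) + (if γ = [] then 0 else F γ) := by
    intro γ; by_cases h : γ = [] <;> simp [h]
  rw [tsum_congr h1, ENNReal.tsum_add, tsum_ite_eq]
  congr 1
  have hinj : Function.Injective fun z : V × List V => z.1 :: z.2 := by
    rintro ⟨a, l⟩ ⟨b, m⟩ h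
    simpa using h
  rw [← hinj.tsum_eq, ENNReal.tsum_prod', tsum_fintype]
  · simp
  · intro γ hγ
    cases γ with
    | nil => simp at hγ
    | cons a l => exact ⟨(a, l), rfl⟩

variable [DecidableEq V] (G : SimpleGraph V) [DecidableRel G.Adj] (v : V)

theorem tsum_pathWeight_root (f : List V → ℝ≥0∞) :
    ∑' γ, pathWeight G v (v :: γ) * f γ = f [] := by
  rw [tsum_list]
  simp [pathWeight]

theorem tsum_pathWeight_of_ne {s : V} (hs : s ≠ v) (f : List V → ℝ≥0∞) :
    ∑' γ, pathWeight G v (s :: γ) * f γ =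
      ∑ y, randomNeighbor G s y * ∑' γ, pathWeight G v (y :: γ) * f (y :: γ) := by
  rw [tsum_list]
  simp only [pathWeight, hs, if_false, zero_mul, zero_add, mul_assoc, ENNReal.tsum_mul_left]

theorem tsum_pathWeight_le_one (s : V) : ∑' γ, pathWeight G v (s :: γ) ≤ 1 := by
  -- Truncating by length makes induction by first steps possible without knowing that the walk is
  -- absorbed; the full sum is the supremum of finite sums.
  have key : ∀ (n : ℕ) (s : V),
      ∑' γ : List V, pathWeight G v (s :: γ) * (if γ.length ≤ n then 1 else 0) ≤ 1 := by
    intro n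
    induction n with
    | zero =>
      intro s
      by_cases hs : s = v
      · rw [hs, tsum_pathWeight_root]; simp
      · rw [tsum_pathWeight_of_ne G v hs]; simp
    | succ n ih =>
      intro s
      by_cases hs : s = v
      · rw [hs, tsum_pathWeight_root]; simp
      · rw [tsum_pathWeight_of_ne G v hs]
        refine le_trans (Finset.sum_le_sum (g := fun y => randomNeighbor G s y * 1)
          fun y _ => mul_le_mul_right ?_ _) ?_
        · simpa using ih y
        · simp [sum_randomNeighbor]
  rw [ENNReal.tsum_eq_iSup_sum]
  refine iSup_le fun A => le_trans ?_ (key (A.sup List.length) s)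
  refine le_trans (Finset.sum_le_sum fun γ hγ => ?_) (ENNReal.sum_le_tsum A)
  rw [if_pos (Finset.le_sup hγ), mul_one]

variable {G v} in
theorem pathWeight_le_prod (s : V) (l : List V) : pathWeight G v (s :: l) ≤
    ∏ i ∈ Finset.range l.length,
      randomNeighbor G ((s :: l).getD i v) ((s :: l).getD (i + 1) v) := by
  induction l generalizing s with
  | nil => simp only [pathWeight]; split_ifs <;> simp
  | cons y l ih =>
    rw [List.length_cons, Finset.prod_range_succ', mul_comm]
    simp only [pathWeight]
    split_ifs
    · simp
    · simpa using mul_le_mul_right (ih y) (randomNeighbor G s y)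

end PathWeight

/-! ### Measurability of quantities read at a first hitting time -/

section Measurability

open MeasureTheory

theorem measurable_dite_find {Ω β : Type*} [MeasurableSpace Ω] [MeasurableSpace β]
    {P : ℕ → Ω → Prop} (hP : ∀ n, MeasurableSet {ω | P n ω}) {F : ℕ → Ω → β}
    (hF : ∀ n, Measurable (F n)) (c : β) {f : Ω → β}
    (hf : ∀ n ω, P n ω → (∀ m < n, ¬ P m ω) → f ω = F n ω) (hf' : ∀ ω, (∀ n, ¬ P n ω) → f ω = c) :
    Measurable f := by
  classical
  intro B hB
  have : f ⁻¹' B = (⋃ n, (({ω | P n ω} ∩ ⋂ m, ⋂ (_ : m < n), {ω | P m ω}ᶜ) ∩ F n ⁻¹' B)) ∪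
      ((⋂ n, {ω | P n ω}ᶜ) ∩ {_ω | c ∈ B}) := by
    ext ω
    simp only [Set.mem_preimage, Set.mem_union, Set.mem_iUnion, Set.mem_inter_iff, Set.mem_iInter,
      Set.mem_compl_iff, Set.mem_ofPred_eq]
    constructor
    · intro h
      by_cases he : ∃ n, P n ω
      · refine .inl ⟨Nat.find he, ⟨Nat.find_spec he, fun m hm => Nat.find_min he hm⟩, ?_⟩
        rwa [← hf _ ω (Nat.find_spec he) fun m hm => Nat.find_min he hm]
      · push Not at he
        exact .inr ⟨he, hf' ω he ▸ h⟩
    · rintro (⟨n, ⟨h1, h2⟩, h3⟩ | ⟨h1, h2⟩)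
      · rwa [hf n ω h1 h2]
      · rwa [hf' ω h1]
  rw [this]
  refine .union (.iUnion fun n => .inter (.inter (hP n) (.iInter fun m => .iInter fun _ =>
    (hP m).compl)) (hF n hB)) (.inter (.iInter fun n => (hP n).compl) (.const _))

variable {Ω V : Type*} [MeasurableSpace Ω]

theorem find_eq_of_forall_lt {P : ℕ → Prop} [DecidablePred P] (h : ∃ n, P n) {n : ℕ} (hn : P n)
    (hlt : ∀ m < n, ¬ P m) : Nat.find h = n :=
  (Nat.find_eq_iff h).2 ⟨hn, hlt⟩

theorem absorbedPath_eq [DecidableEq V] {v : V} {W : ℕ → V} {n : ℕ} (hn : W n = v)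
    (hlt : ∀ m < n, W m ≠ v) : absorbedPath v W = (List.range (n + 1)).map W := by
  classical
  have he : ∃ n, W n = v := ⟨n, hn⟩
  rw [absorbedPath, dif_pos he, find_eq_of_forall_lt he hn hlt]

theorem measurable_absorbedPath [DecidableEq V] [Countable V] [MeasurableSpace (List V)] (v : V)
    {W : ℕ → Ω → V} (hW : ∀ n x, MeasurableSet {ω | W n ω = x}) :
    Measurable fun ω => absorbedPath v fun n => W n ω := by
  let : MeasurableSpace V := ⊤
  have hW' : ∀ n, Measurable (W n) := fun n => measurable_to_countable' fun x => hW n x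
  refine measurable_dite_find (P := fun n ω => W n ω = v) (fun n => hW n v)
    (F := fun n ω => (List.range (n + 1)).map fun n => W n ω) (fun n => ?_) []
    (fun n ω h1 h2 => absorbedPath_eq h1 h2) (fun ω h => ?_)
  · have h1 : Measurable fun ω (i : Fin (n + 1)) => W i ω := measurable_pi_lambda _ fun i => hW' i
    have h2 : (fun ω => (List.range (n + 1)).map fun n => W n ω) =
        List.ofFn ∘ fun ω (i : Fin (n + 1)) => W i ω := by
      ext1 ω
      refine List.ext_getElem (by simp) fun i h1 h2 => ?_
      simp only [Function.comp_apply, List.getElem_map, List.getElem_range, List.getElem_ofFn]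
    rw [h2]
    exact (measurable_of_countable _).comp h1
  · rw [absorbedPath, dif_neg (by simpa using h)]

theorem measurable_finalStacks [DecidableEq V] [MeasurableSpace (State V)]
    [DiscreteMeasurableSpace (State V)]
    [MeasurableSpace (V → List V)] {X : ℕ → Ω → State V} (hX : ∀ n, Measurable (X n)) :
    Measurable fun ω => finalStacks fun n => X n ω := by
  classical
  refine measurable_dite_find (P := fun n ω => (X n ω).trail = [])
    (fun n => hX n (MeasurableSet.of_discrete (s := {σ : State V | σ.trail = []})))
    (F := fun n ω => (X n ω).stack)
    (fun n => (Measurable.of_discrete (f := State.stack)).comp (hX n)) (fun _ => [])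
    (fun n ω h1 h2 => ?_) (fun ω h => ?_)
  · have he : ∃ n, (X n ω).trail = [] := ⟨n, h1⟩
    rw [finalStacks, dif_pos he, find_eq_of_forall_lt he h1 h2]
  · rw [finalStacks, dif_neg (by simpa using h)]

end Measurability

/-! ### Law and expectations of the loop-included path -/

section Main

open MeasureTheory
open scoped ENNReal

variable {V : Type*} [Fintype V]

instance : Countable (State V) := by
  refine Function.Injective.countable (f := fun σ : State V => (σ.stack, σ.gray, σ.trail)) ?_
  rintro ⟨a, b, c⟩ ⟨a', b', c'⟩ h
  simpa using h

variable [DecidableEq V] {G : SimpleGraph V} [DecidableRel G.Adj] {v : V} {order : List V}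
  {Ω : Type*} [MeasurableSpace Ω] {μ : Measure Ω} {X : ℕ → Ω → State V}

theorem exists_lintegral_steps_le (hG : G.Connected)
    (hX : IsMarkovChain μ (wilson G order) (State.init order v) X)
    (hInv : ∀ᵐ ω ∂μ, ∀ n, Inv order v (X n ω)) :
    ∃ C : ℝ≥0∞, C ≠ ∞ ∧ ∫⁻ ω, ∑' n, (if (X n ω).trail = [] then 0 else 1) ∂μ ≤ C := by
  obtain ⟨h, hfin, hh⟩ := exists_hittingTime_ennreal hG v
  refine ⟨potential h (State.init order v), ?_, hX.lintegral_tsum_le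
    (g := fun σ => if σ.trail = [] then 0 else 1) (f := potential h) fun n => ?_⟩
  · refine ENNReal.add_ne_top.2 ⟨ENNReal.mul_ne_top (ENNReal.sum_ne_top.2 fun u _ => hfin u)
      (ENNReal.natCast_ne_top _), ?_⟩
    cases (State.init order v).trail.head? with
    | none => simp
    | some u => exact hfin u
  · filter_upwards [hInv] with ω hω
    exact potential_drift hh (hω n)

theorem ae_isStoppingRun (hG : G.Connected)
    (hX : IsMarkovChain μ (wilson G order) (State.init order v) X) :
    (∀ᵐ ω ∂μ, IsStoppingRun order v fun n => X n ω) ∧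
      ∀ s, ∫⁻ ω, ((finalStacks (fun n => X n ω) s).length : ℝ≥0∞) ∂μ ≠ ∞ := by
  let : MeasurableSpace (State V) := ⊤
  have : Nonempty V := ⟨v⟩
  have hsteps : ∀ᵐ ω ∂μ, X 0 ω = State.init order v ∧
      ∀ n, ∃ w, X (n + 1) ω = (X n ω).step order w := by
    filter_upwards [hX.start, hX.ae_mem_support] with ω h1 h2
    exact ⟨h1, fun n => exists_eq_step_of_wilson_ne_zero (h2 n)⟩
  have hInv : ∀ᵐ ω ∂μ, ∀ n, Inv order v (X n ω) := by
    filter_upwards [hsteps] with ω hω n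
    induction n with
    | zero => rw [hω.1]; exact inv_init _ _
    | succ n ih =>
      obtain ⟨w, hw⟩ := hω.2 n
      rw [hw]
      exact inv_step ih w
  obtain ⟨C, hC, hle⟩ := exists_lintegral_steps_le hG hX hInv
  have hmeas : Measurable fun ω => ∑' n, (if (X n ω).trail = [] then (0 : ℝ≥0∞) else 1) :=
    .tsum fun n => (Measurable.of_discrete (f := fun σ : State V =>
      if σ.trail = [] then (0 : ℝ≥0∞) else 1)).comp (hX.measurable n)
  have hrun : ∀ᵐ ω ∂μ, IsStoppingRun order v fun n => X n ω := by
    filter_upwards [hsteps, ae_lt_top hmeas (hle.trans_lt hC.lt_top).ne] with ω h1 h2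
    refine ⟨h1.1, h1.2, ?_⟩
    -- A run that never stops makes the total number of steps infinite, although its expectation is
    -- finite.
    by_contra! h
    simp only [h, if_false] at h2
    rw [ENNReal.tsum_const_eq_top_of_ne_zero one_ne_zero] at h2
    exact lt_irrefl _ h2
  refine ⟨hrun, fun s => ((lintegral_mono_ae ?_).trans_lt (hle.trans_lt hC.lt_top)).ne⟩
  filter_upwards [hrun] with ω hω
  exact hω.length_finalStacks_le s

/-- The final stacks start with given entries with at most the probability that independent random
neighbours are equal to these entries. -/
theorem measure_prefix_finalStacks_le
    (hX : IsMarkovChain μ (wilson G order) (State.init order v) X)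
    (hrun : ∀ᵐ ω ∂μ, IsStoppingRun order v fun n => X n ω) (T : V → List V) :
    μ {ω | ∀ u, T u <+: finalStacks (fun n => X n ω) u} ≤
      ∏ u, prefixProb (randomNeighbor G u) (T u) [] := by
  let : MeasurableSpace (State V) := ⊤
  let : MeasurableSpace (V → List V) := ⊤
  set f : State V → ℝ≥0∞ := fun σ => ∏ u, prefixProb (randomNeighbor G u) (T u) (σ.stack u)
    with hf
  set E := {ω | ∀ u, T u <+: finalStacks (fun n => X n ω) u} with hE
  have hEm : MeasurableSet E := measurable_finalStacks hX.measurable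
    (MeasurableSet.of_discrete (s := {S : V → List V | ∀ u, T u <+: S u}))
  have h1 : ∀ n, ∫⁻ ω, f (X n ω) ∂μ ≤ f (State.init order v) :=
    hX.lintegral_le fun σ => (tsum_wilson_prod_prefixProb order T σ).le
  -- On `E` the martingale equals 1 from the stopping time on; Fatou's lemma then needs only this
  -- lower bound.
  have h2 : ∀ᵐ ω ∂μ, E.indicator 1 ω ≤ Filter.liminf (fun n => f (X n ω)) Filter.atTop := by
    filter_upwards [hrun] with ω hω
    by_cases hωE : ω ∈ E
    · obtain ⟨N, hN⟩ := hω.terminates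
      have : ∀ᶠ n in Filter.atTop, (1 : ℝ≥0∞) = f (X n ω) := by
        filter_upwards [Filter.eventually_ge_atTop N] with n hn
        rw [hω.eq_of_le hN hn, hf]
        refine (Finset.prod_eq_one fun u _ => prefixProb_of_prefix _ ?_).symm
        rw [← hω.finalStacks_eq hN]
        exact hωE u
      rw [Set.indicator_of_mem hωE, (tendsto_const_nhds.congr' this).liminf_eq]
      rfl
    · rw [Set.indicator_of_notMem hωE]; exact zero_le
  calc μ E = ∫⁻ ω, E.indicator 1 ω ∂μ := (lintegral_indicator_one hEm).symm
    _ ≤ ∫⁻ ω, Filter.liminf (fun n => f (X n ω)) Filter.atTop ∂μ := lintegral_mono_ae h2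
    _ ≤ Filter.liminf (fun n => ∫⁻ ω, f (X n ω) ∂μ) Filter.atTop :=
      lintegral_liminf_le fun n => (Measurable.of_discrete (f := f)).comp (hX.measurable n)
    _ ≤ Filter.liminf (fun _ => f (State.init order v)) Filter.atTop :=
      Filter.liminf_le_liminf (.of_forall h1)
    _ = f (State.init order v) := Filter.liminf_const _

variable (X) in
/-- The loop-included path from `s` of the run `X`. -/
noncomputable def runPath (v s : V) (ω : Ω) : List V :=
  loopIncludedPath v (finalStacks fun n => X n ω) s

variable (hX : IsMarkovChain μ (wilson G order) (State.init order v) X)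
  (hrun : ∀ᵐ ω ∂μ, IsStoppingRun order v fun n => X n ω) (hmem : ∀ u, u ∈ order ↔ u ≠ v)

include hX in
theorem measurable_runPath [MeasurableSpace (List V)] (s : V) : Measurable (runPath X v s) := by
  let : MeasurableSpace (State V) := ⊤
  let : MeasurableSpace (V → List V) := ⊤
  exact (Measurable.of_discrete (f := fun S => loopIncludedPath v S s)).comp
    (measurable_finalStacks hX.measurable)

include hrun hmem in
theorem ae_isCompletePath (s : V) : ∀ᵐ ω ∂μ,
    IsCompletePath v (finalStacks fun n => X n ω) s (runPath X v s ω) := by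
  filter_upwards [hrun] with ω hω
  exact hω.isCompletePath hmem s

include hX hrun hmem in
theorem measure_runPath_le (s : V) (γ : List V) :
    μ {ω | runPath X v s ω = γ} ≤ pathWeight G v γ := by
  by_cases hγ : γ.getLast? = some v ∧ v ∉ γ.dropLast
  · rw [← prod_prefixProb_pathStacks hγ.1 hγ.2]
    refine le_trans (measure_mono_ae ?_) (measure_prefix_finalStacks_le hX hrun (pathStacks γ))
    filter_upwards [ae_isCompletePath hrun hmem s] with ω hω h u
    have := hω.prefix_stack u
    rwa [show runPath X v s ω = γ from h] at this
  · refine le_of_eq_of_le (measure_eq_zero_iff_ae_notMem.2 ?_) zero_le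
    filter_upwards [ae_isCompletePath hrun hmem s] with ω hω h
    obtain rfl : runPath X v s ω = γ := h
    exact hγ ⟨hω.getLast?, hω.notMem_dropLast⟩

include hX hrun hmem in
theorem lintegral_runPath (s : V) (f : List V → ℝ≥0∞) :
    ∫⁻ ω, f (runPath X v s ω) ∂μ = ∑' l, pathWeight G v (s :: l) * f (s :: l) := by
  let : MeasurableSpace (List V) := ⊤
  have := hX.isProbabilityMeasure
  have hm := measurable_runPath hX s
  have hhead : ∀ γ, γ ∉ Set.range (fun l => s :: l) → μ {ω | runPath X v s ω = γ} = 0 := by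
    intro γ hγ
    rw [measure_eq_zero_iff_ae_notMem]
    filter_upwards [ae_isCompletePath hrun hmem s] with ω hω h
    obtain rfl : runPath X v s ω = γ := h
    obtain ⟨l, hl⟩ := List.head?_eq_some_iff.1 hω.head?
    exact hγ ⟨l, hl.symm⟩
  have hint : ∀ f : List V → ℝ≥0∞, ∫⁻ ω, f (runPath X v s ω) ∂μ =
      ∑' l, μ {ω | runPath X v s ω = s :: l} * f (s :: l) := by
    intro f
    rw [← lintegral_map (f := f) (measurable_of_countable _) hm, lintegral_countable',
      ← (List.cons_injective (a := s)).tsum_eq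
        (f := fun γ => f γ * μ.map (runPath X v s) {γ})]
    · refine tsum_congr fun l => ?_
      rw [Measure.map_apply hm (measurableSet_singleton _), mul_comm]
      rfl
    · intro γ hγ
      by_contra h
      refine hγ ?_
      simp only
      rw [Measure.map_apply hm (measurableSet_singleton _)]
      exact mul_eq_zero_of_right _ (hhead γ h)
  have hone : ∑' l, μ {ω | runPath X v s ω = s :: l} = 1 := by
    simpa using (hint 1).symm
  -- Termwise inequality between a sequence of total mass 1 and one of mass at most 1: a single
  -- strict inequality would make the second mass exceed 1.
  have heq : ∀ l, μ {ω | runPath X v s ω = s :: l} = pathWeight G v (s :: l) := by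
    by_contra! h
    obtain ⟨l, hl⟩ := h
    refine absurd (tsum_pathWeight_le_one G v s) (not_le.2 ?_)
    rw [← hone]
    exact ENNReal.tsum_lt_tsum (by rw [hone]; simp)
      (fun l => measure_runPath_le hX hrun hmem s (s :: l))
      ((measure_runPath_le hX hrun hmem s (s :: l)).lt_of_ne hl)
  rw [hint]
  simp only [heq]

-- First-step analysis on the path weights. Paths from different vertices read from the same run are
-- dependent, but only their individual laws enter.
include hX hrun hmem in
theorem lintegral_count_runPath_of_ne {s u : V} (hs : s ≠ v) :
    ∫⁻ ω, ((runPath X v s ω).count u : ℝ≥0∞) ∂μ = (if s = u then 1 else 0) +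
      ∑ y, randomNeighbor G s y * ∫⁻ ω, ((runPath X v y ω).count u : ℝ≥0∞) ∂μ := by
  have := hX.isProbabilityMeasure
  have hone : ∀ y, ∑' l, pathWeight G v (y :: l) = 1 := fun y => by
    simpa using (lintegral_runPath hX hrun hmem y 1).symm
  have h1 := fun s => lintegral_runPath hX hrun hmem s fun γ => (γ.count u : ℝ≥0∞)
  rw [h1, tsum_pathWeight_of_ne G v hs]
  simp only [h1]
  have h2 : ∀ y, ∑' l, pathWeight G v (y :: l) * ((s :: y :: l).count u : ℝ≥0∞) =
      (if s = u then 1 else 0) + ∑' l, pathWeight G v (y :: l) * ((y :: l).count u : ℝ≥0∞) := by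
    intro y
    nth_rw 1 [← one_mul (if s = u then (1 : ℝ≥0∞) else 0), ← hone y]
    rw [← ENNReal.tsum_mul_right, ← ENNReal.tsum_add]
    refine tsum_congr fun l => ?_
    rw [List.count_cons, Nat.cast_add, mul_add, add_comm]
    simp
  simp only [h2, mul_add, Finset.sum_add_distrib]
  rw [← Finset.sum_mul, sum_randomNeighbor, one_mul]

include hX hrun hmem in
theorem lintegral_count_runPath_root {u : V} (hu : u ≠ v) :
    ∫⁻ ω, ((runPath X v v ω).count u : ℝ≥0∞) ∂μ = 0 := by
  rw [lintegral_runPath hX hrun hmem v fun γ => (γ.count u : ℝ≥0∞), tsum_pathWeight_root]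
  simp [hu.symm]

omit [DecidableRel G.Adj] in
include hrun hmem in
theorem lintegral_count_runPath_ne_top (s : V) {u : V} (hu : u ≠ v)
    (hfin : ∫⁻ ω, ((finalStacks (fun n => X n ω) u).length : ℝ≥0∞) ∂μ ≠ ∞) :
    ∫⁻ ω, ((runPath X v s ω).count u : ℝ≥0∞) ∂μ ≠ ∞ := by
  refine ((lintegral_mono_ae ?_).trans_lt hfin.lt_top).ne
  filter_upwards [ae_isCompletePath hrun hmem s] with ω hω
  exact_mod_cast hω.count_le u hu

theorem integrable_natCast {f : Ω → ℕ} (hf : AEMeasurable f μ)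
    (h : ∫⁻ ω, (f ω : ℝ≥0∞) ∂μ ≠ ∞) : Integrable (fun ω => (f ω : ℝ)) μ := by
  have hf' : AEMeasurable (fun ω => (f ω : ℝ)) μ :=
    (measurable_of_countable (fun n : ℕ => (n : ℝ))).comp_aemeasurable hf
  refine ⟨hf'.aestronglyMeasurable, ?_⟩
  rw [hasFiniteIntegral_iff_norm]
  simpa using h.lt_top

theorem integral_natCast {f : Ω → ℕ} (hf : AEMeasurable f μ) :
    ∫ ω, (f ω : ℝ) ∂μ = (∫⁻ ω, (f ω : ℝ≥0∞) ∂μ).toReal := by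
  have hf' : AEMeasurable (fun ω => (f ω : ℝ)) μ :=
    (measurable_of_countable (fun n : ℕ => (n : ℝ))).comp_aemeasurable hf
  rw [integral_eq_lintegral_of_nonneg_ae (.of_forall fun ω => Nat.cast_nonneg _)
    hf'.aestronglyMeasurable]
  simp

include hX in
theorem measurable_count_runPath (s u : V) : Measurable fun ω => (runPath X v s ω).count u := by
  let : MeasurableSpace (List V) := ⊤
  exact (Measurable.of_discrete (f := List.count u)).comp (measurable_runPath hX s)

include hX hrun hmem in
theorem inv_reducedLaplacian_eq_integral (hG : G.Connected)
    (hfin : ∀ u, ∫⁻ ω, ((finalStacks (fun n => X n ω) u).length : ℝ≥0∞) ∂μ ≠ ∞)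
    (s u : {u : V // u ≠ v}) : (reducedLaplacian G v)⁻¹ s u =
      (∫ ω, ((runPath X v s ω).count (u : V) : ℝ) ∂μ) / G.degree u := by
  have hfin' := fun s => lintegral_count_runPath_ne_top hrun hmem s u.2 (hfin u)
  have hint : ∀ s, ∫ ω, ((runPath X v s ω).count (u : V) : ℝ) ∂μ =
      (∫⁻ ω, ((runPath X v s ω).count (u : V) : ℝ≥0∞) ∂μ).toReal := fun s =>
    integral_natCast (measurable_count_runPath hX s u).aemeasurable
  simp only [hint]
  refine inv_reducedLaplacian_apply hG (fun s =>
    (∫⁻ ω, ((runPath X v s ω).count (u : V) : ℝ≥0∞) ∂μ).toReal) ?_ u (fun s hs => ?_) s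
  · rw [lintegral_count_runPath_root hX hrun hmem u.2, ENNReal.toReal_zero]
  · have hd := degree_ne_zero hG hs
    have hd' : (G.degree s : ℝ) ≠ 0 := by exact_mod_cast hd
    have h1 : (if s = u then (1 : ℝ≥0∞) else 0) ≠ ∞ := by split_ifs <;> simp
    rw [lintegral_count_runPath_of_ne hX hrun hmem hs, sum_randomNeighbor_mul hd,
      ENNReal.toReal_add h1 (ENNReal.mul_ne_top (by simpa using hd)
        (ENNReal.sum_ne_top.2 fun y _ => hfin' y)), ENNReal.toReal_mul, ENNReal.toReal_inv,
      ENNReal.toReal_natCast, ENNReal.toReal_sum fun y _ => hfin' y, mul_add,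
      mul_inv_cancel_left₀ hd']
    congr 1
    split_ifs <;> simp

/-- A walk whose first positions are `s :: l` has this list as its absorbed path, because `v` occurs
only at the end. The default `v` of `getD` is never reached at the indices used. -/
theorem measure_absorbedPath_ge {Ω' : Type*} [MeasurableSpace Ω'] {ν : Measure Ω'}
    {W : ℕ → Ω' → V} {s : V} (hW : IsMarkovChain ν (randomNeighbor G) s W) {l : List V}
    (hlast : (s :: l).getLast? = some v) (hdrop : v ∉ (s :: l).dropLast) :
    pathWeight G v (s :: l) ≤ ν {ω | absorbedPath v (fun n => W n ω) = s :: l} := by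
  refine (pathWeight_le_prod s l).trans ?_
  rw [← hW.history l.length (fun i => (s :: l).getD i v) rfl]
  refine measure_mono fun ω hω => ?_
  have hget : ∀ i (hi : i < (s :: l).length), W i ω = (s :: l)[i] := fun i hi => by
    rw [hω i (Nat.le_of_lt_succ hi)]
    exact List.getD_eq_getElem _ _ hi
  have hv : W l.length ω = v := by
    rw [hget _ (by simp)]
    rw [List.getLast?_eq_getElem?] at hlast
    exact List.getElem_eq_iff (by simp) |>.2 (by simpa using hlast)
  have hlt : ∀ m < l.length, W m ω ≠ v := by
    intro m hm h
    refine hdrop ?_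
    rw [← h, hget m (by simp; omega), ← List.getElem_dropLast (xs := s :: l) (by simpa using hm)]
    exact List.getElem_mem _
  show absorbedPath v _ = _
  rw [absorbedPath_eq hv hlt]
  refine List.ext_getElem (by simp) fun i h1 h2 => ?_
  rw [List.getElem_map, List.getElem_range, hget i h2]

include hX hrun hmem in
theorem map_runPath_eq [MeasurableSpace (List V)] [DiscreteMeasurableSpace (List V)] {s : V}
    {Ω' : Type*} [MeasurableSpace Ω'] {ν : Measure Ω'} {W : ℕ → Ω' → V}
    (hW : IsMarkovChain ν (randomNeighbor G) s W) :
    μ.map (runPath X v s) = ν.map fun ω => absorbedPath v fun n => W n ω := by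
  have hm := measurable_runPath hX s
  have hm' := measurable_absorbedPath v hW.measurableSet
  have := hX.isProbabilityMeasure
  have := hW.isProbabilityMeasure
  have := Measure.isProbabilityMeasure_map (μ := μ) hm.aemeasurable
  have := Measure.isProbabilityMeasure_map (μ := ν) hm'.aemeasurable
  -- Between probability measures one inequality suffices, and on a countable space it is checked on
  -- singletons, where `pathWeight` separates the two sides.
  refine Measure.eq_of_le_of_isProbabilityMeasure (Measure.le_iff.2 fun B hB => ?_)
  rw [← Measure.tsum_indicator_apply_singleton _ B hB,
    ← Measure.tsum_indicator_apply_singleton _ B hB]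
  refine ENNReal.tsum_le_tsum fun γ => Set.indicator_le_indicator ?_
  rw [Measure.map_apply hm (measurableSet_singleton γ),
    Measure.map_apply hm' (measurableSet_singleton γ)]
  by_cases hγ : γ.head? = some s ∧ γ.getLast? = some v ∧ v ∉ γ.dropLast
  · obtain ⟨h1, h2, h3⟩ := hγ
    obtain ⟨l, rfl⟩ := List.head?_eq_some_iff.1 h1
    exact (measure_runPath_le hX hrun hmem s _).trans (measure_absorbedPath_ge hW h2 h3)
  · refine le_of_eq_of_le (measure_eq_zero_iff_ae_notMem.2 ?_) zero_le
    filter_upwards [ae_isCompletePath hrun hmem s] with ω hω h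
    obtain rfl : runPath X v s ω = γ := h
    exact hγ ⟨hω.head?, hω.getLast?, hω.notMem_dropLast⟩

end Main

end LEWalk

open MeasureTheory LEWalk in
theorem mainTheorem5 {V : Type*} [Fintype V] [DecidableEq V]
    (G : SimpleGraph V) [DecidableRel G.Adj] (hG : G.Connected) (v : V)
    (order : List V) (hnodup : order.Nodup) (hmem : ∀ u, u ∈ order ↔ u ≠ v)
    {Ω : Type*} [MeasurableSpace Ω] (μ : MeasureTheory.Measure Ω)
    (X : ℕ → Ω → LEWalk.State V)
    (hX : LEWalk.IsMarkovChain μ (LEWalk.wilson G order) (LEWalk.State.init order v) X) :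
    -- the algorithm stops almost surely, and `L_v` is invertible
    (∀ᵐ ω ∂μ, ∃ n, (X n ω).trail = []) ∧
    IsUnit (LEWalk.reducedLaplacian G v) ∧
    -- visits to `u` along the loop-included path from `s`
    (∀ s u : {u : V // u ≠ v},
      MeasureTheory.Integrable (fun ω => ((LEWalk.loopIncludedPath v
        (LEWalk.finalStacks fun n => X n ω) s).count (u : V) : ℝ)) μ ∧
      (LEWalk.reducedLaplacian G v)⁻¹ s u =
        (∫ ω, ((LEWalk.loopIncludedPath v
          (LEWalk.finalStacks fun n => X n ω) s).count (u : V) : ℝ) ∂μ) / G.degree u) ∧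
    -- visits to `s` in the whole run, which are also counted by the entries of the stack of `s`
    (∀ s : {u : V // u ≠ v},
      MeasureTheory.Integrable (fun ω => (LEWalk.visits (fun n => X n ω) s : ℝ)) μ ∧
      (LEWalk.reducedLaplacian G v)⁻¹ s s =
        (∫ ω, (LEWalk.visits (fun n => X n ω) s : ℝ) ∂μ) / G.degree s ∧
      ∀ᵐ ω ∂μ, LEWalk.visits (fun n => X n ω) s =
        (LEWalk.finalStacks (fun n => X n ω) s).length) ∧
    -- the loop-included path is distributed as a `v`-absorbed random walk
    (∀ (s : V) {Ω' : Type*} [MeasurableSpace Ω'] (ν : MeasureTheory.Measure Ω')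
      (W : ℕ → Ω' → V), LEWalk.IsMarkovChain ν (LEWalk.randomNeighbor G) s W →
      ∀ B : Set (List V),
        μ {ω | LEWalk.loopIncludedPath v (LEWalk.finalStacks fun n => X n ω) s ∈ B} =
          ν {ω' | LEWalk.absorbedPath v (fun n => W n ω') ∈ B}) := by
  obtain ⟨hrun, hfin⟩ := ae_isStoppingRun hG hX
  have hcount : ∀ s u : {u : V // u ≠ v},
      Integrable (fun ω => ((runPath X v s ω).count (u : V) : ℝ)) μ := fun s u =>
    integrable_natCast (measurable_count_runPath hX s u).aemeasurable
      (lintegral_count_runPath_ne_top hrun hmem s u.2 (hfin u))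
  have hinv := inv_reducedLaplacian_eq_integral hX hrun hmem hG hfin
  have hvisits : ∀ᵐ ω ∂μ, ∀ s, visits (fun n => X n ω) s =
      (finalStacks (fun n => X n ω) s).length := by
    filter_upwards [hrun] with ω hω s
    exact hω.visits_eq s
  -- Both counts equal the height of the final stack of `s`: the path exhausts it, and each visit of
  -- the run pushes one entry on it.
  have hvc : ∀ s : {u : V // u ≠ v}, (fun ω => ((runPath X v s ω).count (s : V) : ℝ)) =ᵐ[μ]
      fun ω => (visits (fun n => X n ω) s : ℝ) := by
    intro s
    filter_upwards [hvisits, ae_isCompletePath hrun hmem s] with ω h1 h2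
    rw [h1, h2.count_start s.2]
  refine ⟨?_, isUnit_reducedLaplacian hG v, fun s u => ⟨hcount s u, hinv s u⟩,
    fun s => ⟨?_, ?_, ?_⟩, fun s Ω' _ ν W hW B => ?_⟩
  · filter_upwards [hrun] with ω hω
    exact hω.terminates
  · exact (integrable_congr (hvc s)).1 (hcount s s)
  · rw [hinv, integral_congr_ae (hvc s)]
  · filter_upwards [hvisits] with ω hω
    exact hω s
  · let : MeasurableSpace (List V) := ⊤
    have h := congrArg (fun m => m B) (map_runPath_eq hX hrun hmem hW)
    rwa [Measure.map_apply (measurable_runPath hX s) .of_discrete,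
      Measure.map_apply (measurable_absorbedPath v hW.measurableSet) .of_discrete] at h
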